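/- Let $k$ be a field and let $Q$ be a finite simply laced quiver (finitely many vertices, at most one arrow from $x$ to $y$ for each pair of vertices $(x,y)$, no loops). Let $\Delta$ be a $Q$-set with zero compositions: a $k$-algebra $A_x$ for each vertex $x$ and a non zero $A_{t(a)}$-$A_{s(a)}$-bimodule $M_a$ (with $k$ acting centrally) for each arrow $a$. Put $A=\times_x A_x$, $M=\bigoplus_a M_a$, and let $\Lambda=\Lambda_\Delta=A\oplus M$ be the $k$-algebra with $M\cdot M=0$. Vertices are regarded as idempotents of $\Lambda$. Let $\omega=a_m\cdots a_1$ be a path. A trajectory of duration $n$ over $\omega$ is a sequence $\tau=(t(a_m)^{p_{m+1}},a_m,s(a_m)^{p_m},\dots,a_1,s(a_1)^{p_1})$ of length $n$ with $p_i\ge 0$ (it is $x^n$ if $\omega$ is the path of length zero at $x$), where $x^p$ means $x$ repeated $p$ times; $\tau_\Delta$ is the tensor product over $k$ of the corresponding spaces $A_x$ and $M_a$. Let $\mathsf K^n_\omega=\bigoplus_\tau \mathrm{Hom}_k(\tau_\Delta,\,t(\omega)\Lambda s(\omega))$, over the trajectories $\tau$ of duration $n$ over $\omega$. It is viewed inside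 the Hochschild cochains $\mathrm{Hom}_k(\Lambda^{\otimes n},\Lambda)$ by extending by zero, and its coboundary is the Hochschild coboundary followed by taking the components on the trajectories over $\omega$. Its cohomology is $\mathsf H^n_\omega(\Delta)$. Let $DQ_{\le n}$ be the set of paths of length at most $n$ with different source and target, and $CQ_{\le n}$ the set of cycles of length at most $n$ (source equal to target, vertices included). The cup product of cochains $f'\in\mathsf K^{p}_{\omega'}$ and $f\in\mathsf K^{q}_{\omega}$ is zero if $s(\omega')\ne t(\omega)$; otherwise it is the cochain of $\mathsf K_{\omega'\omega}^{p+q}$ given, on concatenated trajectories, by $f'\otimes f$ followed by the product of $\Lambda$. For cycles it induces a product in cohomology. Identify $\mathsf{HH}^n(A)$ with $\bigoplus_{x\in Q_0}\mathsf H^n_x(\Delta)$. This provides a product on the graded space with degree $n$ component $\mathsf{HH}^n(A)\oplus\bigoplus_{\gamma\in CQ_{\le n},\,\gamma\notin Q_0}\mathsf H^n_\gamma(\Delta)$, which restricts to the cup product of $\mathsf{HH}^\bullet(A)$. Then: 1. The cup product of $\mathsf{HH}^\bullet(\Lambda)$ is zero on the images of the maps $$\bigoplus_{\delta\in DQ_{\le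 n}}\mathsf H^n_\delta(\Delta)\longrightarrow \mathsf{HH}^n(\Lambda)$$ induced by the inclusions of the complexes $\mathsf K_\delta$ in the Hochschild complex: for all $p,q\ge0$, the product of an element of the image in degree $p$ and an element of the image in degree $q$ is zero. Moreover, the cup product of cochains is zero on any two cocycles that belong to $\mathsf D^p=\bigoplus_{\delta\in DQ_{\le p}}\mathsf K^p_\delta$ and $\mathsf D^q$ respectively. 2. The maps $$\mathsf{HH}^n(\Lambda)\longrightarrow \mathsf{HH}^n(A)\oplus\bigoplus_{\gamma\in CQ_{\le n},\ \gamma\notin Q_0}\mathsf H^n_\gamma(\Delta),$$ induced by restricting a Hochschild cochain of $\Lambda$ to $A$ and projecting its values to $A$, and by restricting it to the trajectories over $\gamma$ and applying $z\mapsto xzx$ to its values, where $x=s(\gamma)=t(\gamma)$, form a morphism of graded $k$-algebras: they are linear, multiplicative and unital. -/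

import Mathlib

open scoped DirectSum

namespace HochschildPaths

noncomputable section

section Cohomology

variable {k : Type*} [Field k]
variable {X : ℕ → Type*} [∀ n, AddCommGroup (X n)] [∀ n, Module k (X n)]
variable {Y : ℕ → Type*} [∀ n, AddCommGroup (Y n)] [∀ n, Module k (Y n)]
variable {Z : ℕ → Type*} [∀ n, AddCommGroup (Z n)] [∀ n, Module k (Z n)]

/-- The cocycles of degree `n` of a cochain complex `(X, d)`. The coboundary is given as a map
`d m n h : X m → X n` for each proof `h : m + 1 = n`. -/
abbrev cocycles (d : ∀ m n : ℕ, m + 1 = n → (X m →ₗ[k] X n)) (n : ℕ) : Submodule k (X n) :=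
  LinearMap.ker (d n (n + 1) rfl)

/-- The coboundaries of degree `n`. -/
def coboundaries (d : ∀ m n : ℕ, m + 1 = n → (X m →ₗ[k] X n)) : ∀ n : ℕ, Submodule k (X n)
  | 0 => ⊥
  | m + 1 => LinearMap.range (d m (m + 1) rfl)

/-- The cohomology of `(X, d)` in degree `n`: cocycles modulo coboundaries. -/
def Cohomology (d : ∀ m n : ℕ, m + 1 = n → (X m →ₗ[k] X n)) (n : ℕ) : Type _ :=
  cocycles d n ⧸ (coboundaries d n).submoduleOf (cocycles d n)

instance (d : ∀ m n : ℕ, m + 1 = n → (X m →ₗ[k] X n)) (n : ℕ) : AddCommGroup (Cohomology d n) :=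
  inferInstanceAs (AddCommGroup (cocycles d n ⧸ (coboundaries d n).submoduleOf (cocycles d n)))

instance (d : ∀ m n : ℕ, m + 1 = n → (X m →ₗ[k] X n)) (n : ℕ) : Module k (Cohomology d n) :=
  inferInstanceAs (Module k (cocycles d n ⧸ (coboundaries d n).submoduleOf (cocycles d n)))

/-- The class of a cocycle. -/
def Cohomology.mk (d : ∀ m n : ℕ, m + 1 = n → (X m →ₗ[k] X n)) (n : ℕ) :
    cocycles d n →ₗ[k] Cohomology d n :=
  Submodule.mkQ _

theorem mem_coboundaries (d : ∀ m n : ℕ, m + 1 = n → (X m →ₗ[k] X n)) {m n : ℕ} (h : m + 1 = n)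
    (f : X m) : d m n h f ∈ coboundaries d n := by
  subst h
  exact ⟨f, rfl⟩

theorem coboundaries_induction (d : ∀ m n : ℕ, m + 1 = n → (X m →ₗ[k] X n)) {n : ℕ}
    {P : X n → Prop} (h0 : P 0) (h1 : ∀ m (h : m + 1 = n) (f : X m), P (d m n h f)) {f : X n}
    (hf : f ∈ coboundaries d n) : P f := by
  cases n with
  | zero => rw [(Submodule.mem_bot k).1 hf]; exact h0
  | succ m => obtain ⟨g, rfl⟩ := hf; exact h1 m rfl g

/-- The map induced in cohomology by a morphism of cochain complexes. -/
def Cohomology.map (dX : ∀ m n : ℕ, m + 1 = n → (X m →ₗ[k] X n))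
    (dY : ∀ m n : ℕ, m + 1 = n → (Y m →ₗ[k] Y n)) (φ : ∀ n, X n →ₗ[k] Y n)
    (hφ : ∀ m n h f, φ n (dX m n h f) = dY m n h (φ m f)) (n : ℕ) :
    Cohomology dX n →ₗ[k] Cohomology dY n :=
  Submodule.mapQ _ _
    ((φ n).restrict (p := cocycles dX n) (q := cocycles dY n) (fun f hf => by
      rw [LinearMap.mem_ker] at hf ⊢
      rw [← hφ, hf, map_zero]))
    (by
      rintro ⟨f, hf⟩ hb
      change φ n f ∈ coboundaries dY n
      change f ∈ coboundaries dX n at hb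
      refine coboundaries_induction dX (P := fun f => φ n f ∈ coboundaries dY n) ?_ ?_ hb
      · simp
      · intro m h g
        rw [hφ]
        exact mem_coboundaries _ _ _)

/-- The pairing induced in cohomology by a pairing `μ` of cochains that satisfies the graded
Leibniz rule. -/
def Cohomology.pairing (dX : ∀ m n : ℕ, m + 1 = n → (X m →ₗ[k] X n))
    (dY : ∀ m n : ℕ, m + 1 = n → (Y m →ₗ[k] Y n)) (dZ : ∀ m n : ℕ, m + 1 = n → (Z m →ₗ[k] Z n))
    (μ : ∀ p q n : ℕ, p + q = n → (X p →ₗ[k] Y q →ₗ[k] Z n))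
    (leibniz : ∀ (p q n : ℕ) (h : p + q = n) (f : X p) (g : Y q),
      dZ n (n + 1) rfl (μ p q n h f g) =
        μ (p + 1) q (n + 1) (by omega) (dX p (p + 1) rfl f) g +
          (-1 : k) ^ p • μ p (q + 1) (n + 1) (by omega) f (dY q (q + 1) rfl g))
    (p q : ℕ) : Cohomology dX p →ₗ[k] Cohomology dY q →ₗ[k] Cohomology dZ (p + q) :=
  let B : cocycles dX p →ₗ[k] cocycles dY q →ₗ[k] cocycles dZ (p + q) :=
    LinearMap.mk₂ k
      (fun f g => ⟨μ p q (p + q) rfl f.1 g.1, by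
        have hf := LinearMap.mem_ker.1 f.2
        have hg := LinearMap.mem_ker.1 g.2
        rw [LinearMap.mem_ker, leibniz, hf, hg]
        simp⟩)
      (fun f f' g => by ext; simp) (fun c f g => by ext; simp)
      (fun f g g' => by ext; simp) (fun c f g => by ext; simp)
  let B₁ : cocycles dX p →ₗ[k] cocycles dY q →ₗ[k] Cohomology dZ (p + q) :=
    B.compr₂ (Cohomology.mk dZ (p + q))
  let B₂ : Cohomology dX p →ₗ[k] cocycles dY q →ₗ[k] Cohomology dZ (p + q) :=
    Submodule.liftQ _ B₁ (by
      rintro ⟨f, hf⟩ hb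
      change f ∈ coboundaries dX p at hb
      rw [LinearMap.mem_ker]
      ext ⟨g, hg⟩
      refine (Submodule.Quotient.mk_eq_zero _).2 ?_
      change μ p q (p + q) rfl f g ∈ coboundaries dZ (p + q)
      refine coboundaries_induction dX
        (P := fun f => μ p q (p + q) rfl f g ∈ coboundaries dZ (p + q)) (by simp) ?_ hb
      intro m h f'
      subst h
      have hg' := LinearMap.mem_ker.1 hg
      have h1 := leibniz m q (m + q) rfl f' g
      rw [hg', map_zero, smul_zero, add_zero] at h1
      have h2 : m + q + 1 = m + 1 + q := by omega
      have h3 : ∀ n (e : m + q + 1 = n) (e' : m + 1 + q = n),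
          μ (m + 1) q n e' (dX m (m + 1) rfl f') g ∈ coboundaries dZ n := by
        intro n e e'
        subst e
        rw [← h1]
        exact mem_coboundaries _ _ _
      exact h3 _ h2 rfl)
  (Submodule.liftQ _ B₂.flip (by
      rintro ⟨g, hg⟩ hb
      change g ∈ coboundaries dY q at hb
      rw [LinearMap.mem_ker]
      ext ⟨f, hf⟩
      refine (Submodule.Quotient.mk_eq_zero _).2 ?_
      change μ p q (p + q) rfl f g ∈ coboundaries dZ (p + q)
      refine coboundaries_induction dY
        (P := fun g => μ p q (p + q) rfl f g ∈ coboundaries dZ (p + q)) (by simp) ?_ hb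
      intro m h g'
      subst h
      have hf' := LinearMap.mem_ker.1 hf
      have h1 := leibniz p m (p + m) rfl f g'
      rw [hf', map_zero, LinearMap.zero_apply, zero_add] at h1
      have h4 : μ p (m + 1) (p + (m + 1)) rfl f (dY m (m + 1) rfl g') =
          (-1 : k) ^ p • dZ (p + m) (p + m + 1) rfl (μ p m (p + m) rfl f g') := by
        rw [h1, smul_smul, ← mul_pow]
        simp
        rfl
      rw [h4]
      exact Submodule.smul_mem _ _ (mem_coboundaries dZ (rfl : (p + m) + 1 = p + (m + 1)) _))).flip

end Cohomology

section Hochschild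

variable (k : Type*) [Field k] (R : Type*) [Ring R] [Algebra k R]

/-- Hochschild cochains `Hom_k(R^{⊗ n}, R)`. -/
abbrev HCochain (n : ℕ) : Type _ := MultilinearMap k (fun _ : Fin n => R) R

variable {R}

/-- The sequence `(x₀, …, x_i x_{i+1}, …, x_m)`. -/
def contract {m n : ℕ} (h : m + 1 = n) (i : Fin m) (x : Fin n → R) : Fin m → R := fun j =>
  if j < i then x ⟨j, by omega⟩
  else if j = i then x ⟨j, by omega⟩ * x ⟨j + 1, by omega⟩
  else x ⟨j + 1, by omega⟩

/-- The sequence `(x_s, x_{s+1}, …, x_{s+m-1})`. -/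
def slice {α : Type*} {n : ℕ} (s m : ℕ) (h : s + m ≤ n) (x : Fin n → α) : Fin m → α :=
  fun j => x ⟨s + j, by omega⟩

variable {k}

/-- `F` is linear in each variable. -/
def IsMulti {n : ℕ} (F : (Fin n → R) → R) : Prop :=
  ∀ (x : Fin n → R) (i : Fin n), ∃ φ : R →ₗ[k] R, ∀ v, F (Function.update x i v) = φ v

def IsMulti.toMultilinearMap {n : ℕ} {F : (Fin n → R) → R} (hF : IsMulti (k := k) F) :
    HCochain k R n where
  toFun := F
  map_update_add' := by
    intro inst x i a b
    obtain ⟨φ, hφ⟩ := hF x i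
    have : inst = instDecidableEqFin n := Subsingleton.elim _ _
    subst this
    simp only [hφ, map_add]
  map_update_smul' := by
    intro inst x i a b
    obtain ⟨φ, hφ⟩ := hF x i
    have : inst = instDecidableEqFin n := Subsingleton.elim _ _
    subst this
    simp only [hφ, map_smul]

theorem contract_update {m n : ℕ} (h : m + 1 = n) (i : Fin m) (x : Fin n → R) (l : Fin n) :
    ∃ (j : Fin m) (φ : R →ₗ[k] R), ∀ v,
      contract h i (Function.update x l v) = Function.update (contract h i x) j (φ v) := by
  subst h
  rcases lt_trichotomy (l : ℕ) i with h1 | h1 | h1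
  · refine ⟨⟨l, by omega⟩, LinearMap.id, fun v => ?_⟩
    funext j
    by_cases hj : (j : ℕ) = l
    · have : j = ⟨l, by omega⟩ := Fin.ext hj
      rw [this, Function.update_self]
      simp only [contract, Function.update_apply, Fin.ext_iff, Fin.lt_def, LinearMap.id_apply]
      split_ifs <;> rfl
    · have hj' : j ≠ ⟨l, by omega⟩ := fun e => hj (by rw [e])
      rw [Function.update_of_ne hj']
      simp only [contract, Function.update_apply, Fin.ext_iff, Fin.lt_def]
      split_ifs <;> first | rfl | omega
  · refine ⟨i, LinearMap.mulRight k (x ⟨i + 1, by omega⟩), fun v => ?_⟩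
    funext j
    by_cases hj : j = i
    · subst hj
      rw [Function.update_self]
      simp only [contract, Function.update_apply, Fin.ext_iff, Fin.lt_def, LinearMap.mulRight_apply]
      split_ifs <;> first | rfl | omega
    · have hj2 : (j : ℕ) ≠ i := fun e => hj (Fin.ext e)
      rw [Function.update_of_ne hj]
      simp only [contract, Function.update_apply, Fin.ext_iff, Fin.lt_def]
      split_ifs <;> first | rfl | omega
  · by_cases h2 : (l : ℕ) = i + 1
    · refine ⟨i, LinearMap.mulLeft k (x ⟨i, by omega⟩), fun v => ?_⟩
      funext j
      by_cases hj : j = i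
      · subst hj
        rw [Function.update_self]
        simp only [contract, Function.update_apply, Fin.ext_iff, Fin.lt_def,
          LinearMap.mulLeft_apply]
        split_ifs <;> first | rfl | omega
      · have hj2 : (j : ℕ) ≠ i := fun e => hj (Fin.ext e)
        rw [Function.update_of_ne hj]
        simp only [contract, Function.update_apply, Fin.ext_iff, Fin.lt_def]
        split_ifs <;> first | rfl | omega
    · refine ⟨⟨l - 1, by omega⟩, LinearMap.id, fun v => ?_⟩
      funext j
      by_cases hj : (j : ℕ) = l - 1
      · have : j = ⟨l - 1, by omega⟩ := Fin.ext hj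
        rw [this, Function.update_self]
        simp only [contract, Function.update_apply, Fin.ext_iff, Fin.lt_def, LinearMap.id_apply]
        split_ifs <;> first | rfl | omega
      · have hj' : j ≠ ⟨l - 1, by omega⟩ := fun e => hj (by rw [e])
        rw [Function.update_of_ne hj']
        simp only [contract, Function.update_apply, Fin.ext_iff, Fin.lt_def]
        split_ifs <;> first | rfl | omega

theorem slice_update_of_mem {α : Type*} {n : ℕ} (s m : ℕ) (h : s + m ≤ n) (x : Fin n → α)
    (l : Fin n) (hl : s ≤ l) (hl' : (l : ℕ) < s + m) (v : α) :
    slice s m h (Function.update x l v) =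
      Function.update (slice s m h x) ⟨l - s, by omega⟩ v := by
  funext j
  simp only [slice, Function.update_apply, Fin.ext_iff]
  split_ifs <;> first | rfl | omega

theorem slice_update_of_notMem {α : Type*} {n : ℕ} (s m : ℕ) (h : s + m ≤ n) (x : Fin n → α)
    (l : Fin n) (hl : (l : ℕ) < s ∨ s + m ≤ l) (v : α) :
    slice s m h (Function.update x l v) = slice s m h x := by
  funext j
  simp only [slice, Function.update_apply, Fin.ext_iff]
  split_ifs <;> first | rfl | omega

theorem isMulti_cup {p q n : ℕ} (h : p + q = n) (f : HCochain k R p) (g : HCochain k R q) :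
    IsMulti (k := k) fun x : Fin n → R =>
      f (slice 0 p (by omega) x) * g (slice p q (by omega) x) := by
  intro x i
  by_cases hi : (i : ℕ) < p
  · refine ⟨(LinearMap.mulRight k (g (slice p q (by omega) x))) ∘ₗ
      (f.toLinearMap (slice 0 p (by omega) x) ⟨i, hi⟩), fun v => ?_⟩
    change f (slice 0 p _ (Function.update x i v)) * g (slice p q _ (Function.update x i v)) = _
    rw [slice_update_of_mem 0 p _ x i (by omega) (by omega) v,
      slice_update_of_notMem p q _ x i (by omega) v]
    rfl
  · refine ⟨(LinearMap.mulLeft k (f (slice 0 p (by omega) x))) ∘ₗ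
      (g.toLinearMap (slice p q (by omega) x) ⟨i - p, by omega⟩), fun v => ?_⟩
    change f (slice 0 p _ (Function.update x i v)) * g (slice p q _ (Function.update x i v)) = _
    rw [slice_update_of_mem p q _ x i (by omega) (by omega) v,
      slice_update_of_notMem 0 p _ x i (by omega) v]
    rfl

/-- The cup product of Hochschild cochains:
`(f ⌣ g)(x₀, …, x_{p+q-1}) = f(x₀, …, x_{p-1}) g(x_p, …, x_{p+q-1})`. -/
def cup (p q n : ℕ) (h : p + q = n) : HCochain k R p →ₗ[k] HCochain k R q →ₗ[k] HCochain k R n :=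
  LinearMap.mk₂ k (fun f g => (isMulti_cup h f g).toMultilinearMap)
    (fun f f' g => by ext x; exact add_mul _ _ _) (fun c f g => by ext x; exact smul_mul_assoc _ _ _)
    (fun f g g' => by ext x; exact mul_add _ _ _) (fun c f g => by ext x; exact mul_smul_comm _ _ _)

theorem cup_apply {p q n : ℕ} (h : p + q = n) (f : HCochain k R p) (g : HCochain k R q)
    (x : Fin n → R) :
    cup p q n h f g x = f (slice 0 p (by omega) x) * g (slice p q (by omega) x) := rfl

theorem isMulti_face {m n : ℕ} (h : m + 1 = n) (f : HCochain k R m) (i : Fin m) :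
    IsMulti (k := k) fun x : Fin n → R => f (contract h i x) := by
  intro x l
  obtain ⟨j, φ, hφ⟩ := contract_update (k := k) h i x l
  exact ⟨(f.toLinearMap (contract h i x) j) ∘ₗ φ, fun v => by
    change f _ = _
    rw [hφ]; rfl⟩

/-- `x₀ ↦ x₀` as a cochain of degree one. -/
def idCochain : HCochain k R 1 :=
  (LinearMap.id : R →ₗ[k] R).compMultilinearMap (MultilinearMap.ofSubsingleton k R R 0 LinearMap.id)

/-- `f ↦ f(x₀, …, x_i x_{i+1}, …, x_m)`. -/
def face (m n : ℕ) (h : m + 1 = n) (i : Fin m) : HCochain k R m →ₗ[k] HCochain k R n where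
  toFun f := (isMulti_face h f i).toMultilinearMap
  map_add' _ _ := rfl
  map_smul' _ _ := rfl

/-- The Hochschild coboundary
`(df)(x₀, …, x_m) = x₀ f(x₁, …, x_m) + ∑ (-1)^{i+1} f(x₀, …, x_i x_{i+1}, …, x_m)
  + (-1)^{m+1} f(x₀, …, x_{m-1}) x_m`; see `hd_apply`. -/
def hd (m n : ℕ) (h : m + 1 = n) : HCochain k R m →ₗ[k] HCochain k R n :=
  cup 1 m n (by omega) idCochain + ∑ i : Fin m, (-1 : k) ^ ((i : ℕ) + 1) • face m n h i +
    (-1 : k) ^ (m + 1) • (cup m 1 n h).flip idCochain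

theorem hd_apply {m n : ℕ} (h : m + 1 = n) (f : HCochain k R m) (x : Fin n → R) :
    hd m n h f x = x ⟨0, by omega⟩ * f (slice 1 m (by omega) x) +
      ∑ i : Fin m, (-1 : k) ^ ((i : ℕ) + 1) • f (contract h i x) +
      (-1 : k) ^ (m + 1) • (f (slice 0 m (by omega) x) * x ⟨m, by omega⟩) := by
  simp only [hd, LinearMap.add_apply, LinearMap.sum_apply, LinearMap.smul_apply,
    LinearMap.flip_apply]
  rw [add_apply, add_apply, sum_apply]
  rfl

theorem hd_cup (p q n : ℕ) (h : p + q = n) (f : HCochain k R p) (g : HCochain k R q) :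
    hd n (n + 1) rfl (cup p q n h f g) =
      cup (p + 1) q (n + 1) (by omega) (hd p (p + 1) rfl f) g +
        (-1 : k) ^ p • cup p (q + 1) (n + 1) (by omega) f (hd q (q + 1) rfl g) := by
  subst h
  ext x
  rw [add_apply, smul_apply]
  simp only [hd_apply, cup_apply]
  rw [Fin.sum_univ_add]
  have hx : ∀ (a b : ℕ) (ha : a < p + q + 1) (hb : b < p + q + 1), a = b →
      x ⟨a, ha⟩ = x ⟨b, hb⟩ := by
    intro a b ha hb e; subst e; rfl
  have e1 : ∀ i : Fin p, slice 0 p (by omega) (contract (rfl : p + q + 1 = _) (Fin.castAdd q i) x) =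
      contract rfl i (slice 0 (p + 1) (by omega) x) := by
    intro i; funext j
    simp only [slice, contract, Fin.lt_def, Fin.ext_iff, Fin.val_castAdd]
    split_ifs <;> first | omega | exact hx _ _ _ _ (by omega) |
      exact congrArg₂ (· * ·) (hx _ _ _ _ (by omega)) (hx _ _ _ _ (by omega))
  have e2 : ∀ i : Fin p, slice p q (by omega) (contract (rfl : p + q + 1 = _) (Fin.castAdd q i) x) =
      slice (p + 1) q (by omega) x := by
    intro i; funext j
    simp only [slice, contract, Fin.lt_def, Fin.ext_iff, Fin.val_castAdd]
    rw [if_neg (by omega), if_neg (by omega)]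
    exact hx _ _ _ _ (by omega)
  have e3 : ∀ i : Fin q, slice 0 p (by omega) (contract (rfl : p + q + 1 = _) (Fin.natAdd p i) x) =
      slice 0 p (by omega) x := by
    intro i; funext j
    simp only [slice, contract, Fin.lt_def, Fin.ext_iff, Fin.val_natAdd]
    rw [if_pos (by omega)]
  have e4 : ∀ i : Fin q, slice p q (by omega) (contract (rfl : p + q + 1 = _) (Fin.natAdd p i) x) =
      contract rfl i (slice p (q + 1) (by omega) x) := by
    intro i; funext j
    simp only [slice, contract, Fin.lt_def, Fin.ext_iff, Fin.val_natAdd]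
    split_ifs <;> first | omega | exact hx _ _ _ _ (by omega) |
      exact congrArg₂ (· * ·) (hx _ _ _ _ (by omega)) (hx _ _ _ _ (by omega))
  have e5 : slice 0 p (by omega) (slice 1 (p + q) (by omega) x) =
      slice 1 p (by omega) (slice 0 (p + 1) (by omega) x) :=
    funext fun j => hx _ _ _ _ (by simp only; omega)
  have e6 : slice p q (by omega) (slice 1 (p + q) (by omega) x) =
      slice (p + 1) q (by omega) x :=
    funext fun j => hx _ _ _ _ (by simp only; omega)
  have e7 : slice 0 p (by omega) (slice 0 (p + q) (by omega) x) = slice 0 p (by omega) x :=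
    funext fun j => hx _ _ _ _ (by simp only; omega)
  have e8 : slice 0 p (by omega) (slice 0 (p + 1) (by omega) x) = slice 0 p (by omega) x :=
    funext fun j => hx _ _ _ _ (by simp only; omega)
  have e9 : slice 1 q (by omega) (slice p (q + 1) (by omega) x) =
      slice (p + 1) q (by omega) x :=
    funext fun j => hx _ _ _ _ (by simp only; omega)
  have e10 : slice 0 q (by omega) (slice p (q + 1) (by omega) x) =
      slice p q (by omega) (slice 0 (p + q) (by omega) x) :=
    funext fun j => hx _ _ _ _ (by simp only; omega)
  have e11 : slice 0 (p + 1) (by omega) x ⟨0, by omega⟩ = x ⟨0, by omega⟩ := rfl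
  have e12 : slice 0 (p + 1) (by omega) x ⟨p, by omega⟩ = x ⟨p, by omega⟩ :=
    hx _ _ _ _ (by simp only; omega)
  have e13 : slice p (q + 1) (by omega) x ⟨0, by omega⟩ = x ⟨p, by omega⟩ := rfl
  have e14 : slice p (q + 1) (by omega) x ⟨q, by omega⟩ = x ⟨p + q, by omega⟩ := rfl
  simp only [e1, e2, e3, e4, e5, e6, e7, e8, e9, e10, e11, e12, e13, e14]
  have s1 : ∀ i : Fin p, ((-1 : k) ^ ((i : ℕ) + 1) •
      f (contract rfl i (slice 0 (p + 1) (by omega) x))) * g (slice (p + 1) q (by omega) x) =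
      (-1 : k) ^ ((i : ℕ) + 1) • (f (contract rfl i (slice 0 (p + 1) (by omega) x)) *
        g (slice (p + 1) q (by omega) x)) := fun i => smul_mul_assoc _ _ _
  have s2 : ∀ i : Fin q, f (slice 0 p (by omega) x) * ((-1 : k) ^ ((i : ℕ) + 1) •
      g (contract rfl i (slice p (q + 1) (by omega) x))) =
      (-1 : k) ^ ((i : ℕ) + 1) • (f (slice 0 p (by omega) x) *
        g (contract rfl i (slice p (q + 1) (by omega) x))) := fun i => mul_smul_comm _ _ _
  simp only [add_mul, mul_add, Finset.sum_mul, Finset.mul_sum, smul_add, Finset.smul_sum, s1, s2,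
    Fin.val_castAdd, Fin.val_natAdd]
  rw [smul_mul_assoc, mul_smul_comm]
  simp only [smul_smul, ← pow_add, mul_assoc]
  have hs : ∀ r : R, (-1 : k) ^ (p + 1) • r = - ((-1 : k) ^ p • r) := by
    intro r; rw [pow_succ, mul_neg_one, neg_smul]
  rw [hs]
  abel

variable (k R)

/-- The Hochschild cohomology `HH^n(R)` of the `k`-algebra `R`. -/
abbrev HH (n : ℕ) : Type _ := Cohomology (X := HCochain k R) hd n

/-- The cup product of Hochschild cohomology. -/
def HH.cup (p q : ℕ) : HH k R p →ₗ[k] HH k R q →ₗ[k] HH k R (p + q) :=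
  Cohomology.pairing (X := HCochain k R) (Y := HCochain k R) (Z := HCochain k R) hd hd hd
    HochschildPaths.cup hd_cup p q

/-- The unit of the algebra `HH^*(R)`: the class of `1 ∈ R` in degree zero. -/
def HH.one : HH k R 0 :=
  Cohomology.mk (X := HCochain k R) hd 0 ⟨MultilinearMap.constOfIsEmpty k _ 1, by
    rw [LinearMap.mem_ker]
    ext x
    rw [hd_apply]
    change x _ * 1 + _ + (-1 : k) ^ (0 + 1) • (1 * x _) = 0
    simp⟩

end Hochschild

section QSets

open Quiver

/-- A `Q`-set `Δ = (A, M)` with zero compositions on a quiver `Q` with set of vertices `V`: a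
`k`-algebra `A x` for each vertex `x`, and a non zero `A y`-`A x`-bimodule `M a` for each arrow
`a : x ⟶ y`, on which both actions restrict to the same action of `k`. The bimodule maps
`M b ⊗ M a → M c` and `M b ⊗ M a → A x` of the `Q`-set are zero, so they are not recorded. -/
structure QSet.{w, u, v₁, v₂} (k : Type u) [Field k] (V : Type v₁) [Quiver.{v₂} V] where
  A : V → Type w
  M : ∀ {x y : V}, (x ⟶ y) → Type w
  [ring : ∀ x, Ring (A x)]
  [algebra : ∀ x, Algebra k (A x)]
  [addCommGroup : ∀ {x y : V} (a : x ⟶ y), AddCommGroup (M a)]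
  [module : ∀ {x y : V} (a : x ⟶ y), Module k (M a)]
  [moduleLeft : ∀ {x y : V} (a : x ⟶ y), Module (A y) (M a)]
  [moduleRight : ∀ {x y : V} (a : x ⟶ y), Module (A x)ᵐᵒᵖ (M a)]
  [smulComm : ∀ {x y : V} (a : x ⟶ y), SMulCommClass (A y) (A x)ᵐᵒᵖ (M a)]
  [towerLeft : ∀ {x y : V} (a : x ⟶ y), IsScalarTower k (A y) (M a)]
  [towerRight : ∀ {x y : V} (a : x ⟶ y), IsScalarTower k (A x)ᵐᵒᵖ (M a)]
  [nontrivial : ∀ {x y : V} (a : x ⟶ y), Nontrivial (M a)]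

attribute [instance] QSet.ring QSet.algebra QSet.addCommGroup QSet.module QSet.moduleLeft
  QSet.moduleRight QSet.smulComm QSet.towerLeft QSet.towerRight QSet.nontrivial

variable {k : Type*} [Field k] {V : Type*} [Quiver V]

namespace QSet

/-- The algebra `A = ×_x A_x`. -/
abbrev Alg (Δ : QSet k V) : Type _ := ∀ x : V, Δ.A x

/-- The bimodule `M = ⊕_a M_a` over the (finitely many) arrows. -/
def Bim (Δ : QSet k V) : Type _ := ∀ a : Total V, Δ.M a.hom

variable (Δ : QSet k V)

instance : AddCommGroup Δ.Bim := inferInstanceAs (AddCommGroup (∀ a : Total V, Δ.M a.hom))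

instance : Module k Δ.Bim := inferInstanceAs (Module k (∀ a : Total V, Δ.M a.hom))

/-- `A` acts on the left of `M_a`, `a : x ⟶ y`, through `A_y`. -/
instance : Module Δ.Alg Δ.Bim where
  smul r m := fun a => r a.right • m a
  one_smul m := funext fun a => one_smul (Δ.A a.right) (m a)
  mul_smul r s m := funext fun a => mul_smul (r a.right) (s a.right) (m a)
  smul_zero r := funext fun a => smul_zero (r a.right)
  smul_add r m m' := funext fun a => smul_add (r a.right) (m a) (m' a)
  add_smul r s m := funext fun a => add_smul (r a.right) (s a.right) (m a)
  zero_smul m := funext fun a => zero_smul (Δ.A a.right) (m a)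

/-- `A` acts on the right of `M_a`, `a : x ⟶ y`, through `A_x`. -/
instance : Module Δ.Algᵐᵒᵖ Δ.Bim where
  smul r m := fun a => MulOpposite.op (r.unop a.left) • m a
  one_smul m := funext fun a => one_smul (Δ.A a.left)ᵐᵒᵖ (m a)
  mul_smul r s m := funext fun a =>
    mul_smul (MulOpposite.op (r.unop a.left)) (MulOpposite.op (s.unop a.left)) (m a)
  smul_zero r := funext fun a => smul_zero (MulOpposite.op (r.unop a.left))
  smul_add r m m' := funext fun a => smul_add (MulOpposite.op (r.unop a.left)) (m a) (m' a)
  add_smul r s m := funext fun a =>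
    add_smul (MulOpposite.op (r.unop a.left)) (MulOpposite.op (s.unop a.left)) (m a)
  zero_smul m := funext fun a => zero_smul (Δ.A a.left)ᵐᵒᵖ (m a)

theorem smul_apply (r : Δ.Alg) (m : Δ.Bim) (a : Total V) : (r • m) a = r a.right • m a := rfl

theorem op_smul_apply (r : Δ.Alg) (m : Δ.Bim) (a : Total V) :
    (MulOpposite.op r • m) a = MulOpposite.op (r a.left) • m a := rfl

instance : SMulCommClass Δ.Alg Δ.Algᵐᵒᵖ Δ.Bim where
  smul_comm r s m := funext fun a =>
    smul_comm (r a.right) (MulOpposite.op (s.unop a.left)) (m a)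

instance : IsScalarTower k Δ.Alg Δ.Bim where
  smul_assoc c r m := funext fun a => smul_assoc c (r a.right) (m a)

instance : IsScalarTower k Δ.Algᵐᵒᵖ Δ.Bim where
  smul_assoc c r m := funext fun a => smul_assoc c (MulOpposite.op (r.unop a.left)) (m a)

/-- The algebra `Λ_Δ = A ⊕ M` with `M M = 0`, arising from the `k`-category with zero compositions
that `Δ` determines. -/
abbrev Lam : Type _ := TrivSqZeroExt Δ.Alg Δ.Bim

/-- The entries of trajectories: a vertex (one unit of waiting time) or an arrow. -/
abbrev Cell (V : Type*) [Quiver V] : Type _ := V ⊕ Total V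

/-- A sequence of vertices and arrows is a trajectory over the path `ω = a_m ⋯ a_1` if it is
`t(a_m)^{p_{m+1}}, a_m, s(a_m)^{p_m}, …, s(a_2)^{p_2}, a_1, s(a_1)^{p_1}` for some waiting times
`p_i ≥ 0` (and `x^p` for the path of length zero at `x`). As in this display, sequences are written
from the target of `ω` to its source. -/
def IsTrajectory : ∀ {x y : V}, Path x y → List (Cell V) → Prop
  | _, _, .nil, [] => True
  | _, _, .cons _ _, [] => False
  | _, y, ω, .inl z :: l => z = y ∧ IsTrajectory ω l
  | _, _, .nil, .inr _ :: _ => False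
  | _, _, .cons ω e, .inr a :: l => a = ⟨_, _, e⟩ ∧ IsTrajectory ω l

/-- The set `T_n(ω)` of trajectories of duration `n` over `ω`. -/
abbrev Trajectory {x y : V} (ω : Path x y) (n : ℕ) : Type _ :=
  {τ : Fin n → Cell V // IsTrajectory ω (List.ofFn τ)}

/-- The space attached to an entry of a trajectory: `A_x` for a vertex, `M_a` for an arrow. -/
def Space : Cell V → Type _
  | .inl x => Δ.A x
  | .inr a => Δ.M a.hom

instance : ∀ c, AddCommGroup (Δ.Space c)
  | .inl x => inferInstanceAs (AddCommGroup (Δ.A x))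
  | .inr a => inferInstanceAs (AddCommGroup (Δ.M a.hom))

instance : ∀ c, Module k (Δ.Space c)
  | .inl x => inferInstanceAs (Module k (Δ.A x))
  | .inr a => inferInstanceAs (Module k (Δ.M a.hom))

/-- The inclusion of `M` in `Λ_Δ`. -/
def inrLin : Δ.Bim →ₗ[k] Δ.Lam where
  toFun := TrivSqZeroExt.inr
  map_add' _ _ := TrivSqZeroExt.inr_add _ _ _
  map_smul' _ _ := TrivSqZeroExt.inr_smul _ _ _

/-- The projection of `Λ_Δ` onto `M`. -/
def sndLin : Δ.Lam →ₗ[k] Δ.Bim where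
  toFun := TrivSqZeroExt.snd
  map_add' _ _ := rfl
  map_smul' _ _ := rfl

/-- The projection of `Λ_Δ` onto its quotient algebra `A`. -/
abbrev fstLin : Δ.Lam →ₗ[k] Δ.Alg := (TrivSqZeroExt.fstHom k Δ.Alg Δ.Bim).toLinearMap

/-- The inclusion of the subalgebra `A` in `Λ_Δ`. -/
abbrev inlLin : Δ.Alg →ₗ[k] Δ.Lam := (TrivSqZeroExt.inlAlgHom k Δ.Alg Δ.Bim).toLinearMap

open scoped Classical in
/-- An element of `A_x` as an element of `Λ_Δ`. -/
def ofA (x : V) : Δ.A x →ₗ[k] Δ.Lam := Δ.inlLin ∘ₗ LinearMap.single k Δ.A x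

open scoped Classical in
/-- An element of `M_a` as an element of `Λ_Δ`. -/
def ofM (a : Total V) : Δ.M a.hom →ₗ[k] Δ.Lam :=
  Δ.inrLin ∘ₗ LinearMap.single k (fun b : Total V => Δ.M b.hom) a

/-- The inclusion of `A_x`, or of `M_a`, in `Λ_Δ`. -/
def incl : ∀ c, Δ.Space c →ₗ[k] Δ.Lam
  | .inl x => Δ.ofA x
  | .inr a => Δ.ofM a

/-- The projection of `Λ_Δ` onto its summand `A_x`, or `M_a`. -/
def proj : ∀ c, Δ.Lam →ₗ[k] Δ.Space c
  | .inl x => LinearMap.proj (R := k) (φ := Δ.A) x ∘ₗ Δ.fstLin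
  | .inr a => LinearMap.proj (R := k) (φ := fun b : Total V => Δ.M b.hom) a ∘ₗ Δ.sndLin

/-- The vertex `x` as an idempotent of `Λ_Δ`. -/
def e (x : V) : Δ.Lam := Δ.ofA x 1

/-- The map `z ↦ y z x` of `Λ_Δ`, for vertices `y` and `x`. -/
def corner (y x : V) : Δ.Lam →ₗ[k] Δ.Lam :=
  LinearMap.mulRight k (Δ.e x) ∘ₗ LinearMap.mulLeft k (Δ.e y)

/-- The bimodule `Δ_ω = t(ω) Λ_Δ s(ω)`. -/
def counterpart {x y : V} (_ω : Path x y) : Submodule k Δ.Lam := LinearMap.range (Δ.corner y x)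

instance {x y : V} (ω : Path x y) : MulAction k (Δ.counterpart ω) :=
  (Δ.counterpart ω).module.toDistribMulAction.toMulAction

/-- The cochains `K_ω^n = ⊕_τ Hom_k(τ_Δ, Δ_ω)`, over the trajectories `τ` of duration `n` over `ω`.
A linear map on the tensor product `τ_Δ` is given by a multilinear map. -/
def KCochain {x y : V} (ω : Path x y) (n : ℕ) : Type _ :=
  ∀ τ : Trajectory ω n, MultilinearMap k (fun i => Δ.Space (τ.1 i)) (Δ.counterpart ω)

instance {x y : V} (ω : Path x y) (n : ℕ) : AddCommGroup (Δ.KCochain ω n) :=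
  inferInstanceAs (AddCommGroup
    (∀ τ : Trajectory ω n, MultilinearMap k (fun i => Δ.Space (τ.1 i)) (Δ.counterpart ω)))

instance {x y : V} (ω : Path x y) (n : ℕ) : Module k (Δ.KCochain ω n) :=
  inferInstanceAs (Module k
    (∀ τ : Trajectory ω n, MultilinearMap k (fun i => Δ.Space (τ.1 i)) (Δ.counterpart ω)))

/-- The component along `ω` of a cochain `g : Λ_Δ^{⊗ n} → Λ_Δ`: for each trajectory `τ` over `ω`,
restrict `g` to `τ_Δ` and compose with the projection `z ↦ t(ω) z s(ω)`. -/
def component {x y : V} (ω : Path x y) (n : ℕ) : HCochain k Δ.Lam n →ₗ[k] Δ.KCochain ω n where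
  toFun g := fun τ => (Δ.corner y x).rangeRestrict.compMultilinearMap
    (g.compLinearMap fun i => Δ.incl (τ.1 i))
  map_add' g g' := by
    funext τ
    exact MultilinearMap.ext fun v => map_add (Δ.corner y x).rangeRestrict _ _
  map_smul' c g := by
    funext τ
    exact MultilinearMap.ext fun v => map_smul (Δ.corner y x).rangeRestrict c _

section Fin

variable [Finite V] [∀ x y : V, Subsingleton (x ⟶ y)]

instance : Finite (Total V) :=
  Finite.of_injective (fun a : Total V => (a.left, a.right)) (by
    rintro ⟨x, y, a⟩ ⟨x', y', a'⟩ h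
    obtain ⟨rfl, rfl⟩ := Prod.mk.inj h
    rw [Subsingleton.elim a a'])

instance {x y : V} (ω : Path x y) (n : ℕ) : Finite (Trajectory ω n) :=
  inferInstance

instance {x y : V} (ω : Path x y) (n : ℕ) : Fintype (Trajectory ω n) := Fintype.ofFinite _

/-- A cochain along `ω` viewed as a cochain `Λ_Δ^{⊗ n} → Λ_Δ`, zero on the summands that do not
belong to a trajectory over `ω`. -/
def extend {x y : V} (ω : Path x y) (n : ℕ) : Δ.KCochain ω n →ₗ[k] HCochain k Δ.Lam n where
  toFun f := ∑ τ : Trajectory ω n, (Δ.counterpart ω).subtype.compMultilinearMap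
    ((f τ).compLinearMap fun i => Δ.proj (τ.1 i))
  map_add' f f' := by
    rw [← Finset.sum_add_distrib]
    rfl
  map_smul' c f := by
    rw [Finset.smul_sum]
    rfl

/-- The coboundary of the complex `K_ω`: view a cochain along `ω` as a cochain of `Λ_Δ`, take the
Hochschild coboundary `d` there, and keep the components `(d f)_σ` on trajectories `σ` over `ω`,
that is on those obtained by increasing one waiting time by one. -/
def kd {x y : V} (ω : Path x y) (m n : ℕ) (h : m + 1 = n) :
    Δ.KCochain ω m →ₗ[k] Δ.KCochain ω n :=
  Δ.component ω n ∘ₗ hd m n h ∘ₗ Δ.extend ω m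

end Fin

theorem isTrajectory_cons_inl {x y : V} (ω : Path x y) (z : V) (l : List (Cell V)) :
    IsTrajectory ω (.inl z :: l) ↔ z = y ∧ IsTrajectory ω l := by
  cases ω <;> rfl

theorem isTrajectory_append_inl (z : V) (l : List (Cell V)) : ∀ {x y : V} (ω : Path x y),
    IsTrajectory ω (l ++ [.inl z]) ↔ z = x ∧ IsTrajectory ω l := by
  induction l with
  | nil =>
    intro x y ω
    cases ω <;> simp [IsTrajectory]
  | cons c l ih =>
    intro x y ω
    rcases c with w | a
    · rw [List.cons_append, isTrajectory_cons_inl, isTrajectory_cons_inl, ih]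
      tauto
    · cases ω with
      | nil => simp [IsTrajectory]
      | cons ω e =>
        rw [List.cons_append]
        simp only [IsTrajectory]
        rw [ih]
        tauto

/-- The products of two entries that do not vanish. -/
inductive Splits : Cell V → Cell V → Cell V → Prop
  | vertex (x : V) : Splits (.inl x) (.inl x) (.inl x)
  | left (a : Total V) : Splits (.inr a) (.inl a.right) (.inr a)
  | right (a : Total V) : Splits (.inr a) (.inr a) (.inl a.left)

theorem isTrajectory_splits {c c₁ c₂ : Cell V} (hc : Splits c c₁ c₂) (r : List (Cell V))
    (l : List (Cell V)) : ∀ {x y : V} (ω : Path x y),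
    IsTrajectory ω (l ++ c :: r) ↔ IsTrajectory ω (l ++ c₁ :: c₂ :: r) := by
  induction l with
  | nil =>
    intro x y ω
    cases hc with
    | vertex z =>
      simp only [List.nil_append, isTrajectory_cons_inl]
      tauto
    | left a =>
      simp only [List.nil_append, isTrajectory_cons_inl]
      cases ω with
      | nil => simp [IsTrajectory]
      | cons ω e =>
        simp only [IsTrajectory]
        constructor
        · rintro ⟨rfl, h⟩
          exact ⟨rfl, rfl, h⟩
        · rintro ⟨-, h⟩
          exact h
    | right a =>
      cases ω with
      | nil => simp [IsTrajectory]
      | cons ω e =>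
        simp only [List.nil_append, IsTrajectory, isTrajectory_cons_inl]
        constructor
        · rintro ⟨rfl, h⟩
          exact ⟨rfl, rfl, h⟩
        · rintro ⟨h, -, h'⟩
          exact ⟨h, h'⟩
  | cons d l ih =>
    intro x y ω
    rcases d with w | a
    · simp only [List.cons_append, isTrajectory_cons_inl]
      rw [ih]
    · cases ω with
      | nil => simp [IsTrajectory]
      | cons ω e =>
        simp only [List.cons_append, IsTrajectory]
        rw [ih]

theorem ofFn_cons_slice {α : Type*} {m n : ℕ} (h : m + 1 = n) (σ : Fin n → α) :
    List.ofFn σ = σ ⟨0, by omega⟩ :: List.ofFn (slice 1 m (by omega) σ) := by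
  subst h
  rw [List.ofFn_succ]
  congr 2
  funext j
  simp only [slice]
  congr 1
  ext
  simp [add_comm]

theorem ofFn_slice_append {α : Type*} {m n : ℕ} (h : m + 1 = n) (σ : Fin n → α) :
    List.ofFn σ = List.ofFn (slice 0 m (by omega) σ) ++ [σ ⟨m, by omega⟩] := by
  subst h
  rw [List.ofFn_succ']
  rw [List.concat_eq_append]
  congr 2
  funext j
  simp only [slice]
  congr 1
  ext
  simp

theorem isTrajectory_contract {m n : ℕ} (h : m + 1 = n) (σ : Fin n → Cell V) (i : Fin m)
    (c : Cell V) (hc : Splits c (σ ⟨i, by omega⟩) (σ ⟨i + 1, by omega⟩)) {x y : V} (ω : Path x y) :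
    IsTrajectory ω (List.ofFn fun j : Fin m => if j < i then σ ⟨j, by omega⟩
      else if j = i then c else σ ⟨j + 1, by omega⟩) ↔ IsTrajectory ω (List.ofFn σ) := by
  subst h
  obtain ⟨L, hL⟩ : ∃ L, L = List.ofFn σ := ⟨_, rfl⟩
  have hlen : L.length = m + 1 := by rw [hL, List.length_ofFn]
  have hget : ∀ (j : ℕ) (hj : j < L.length), L[j] = σ ⟨j, by omega⟩ := by
    subst hL
    intro j hj
    rw [List.getElem_ofFn]
  have e1 : L = L.take i ++ σ ⟨i, by omega⟩ :: σ ⟨i + 1, by omega⟩ :: L.drop (i + 2) := by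
    conv_lhs => rw [← List.take_append_drop i L]
    rw [List.drop_eq_getElem_cons (by omega), List.drop_eq_getElem_cons (by omega), hget, hget]
  have e2 : (List.ofFn fun j : Fin m => if j < i then σ ⟨j, by omega⟩
      else if j = i then c else σ ⟨j + 1, by omega⟩) = L.take i ++ c :: L.drop (i + 2) := by
    have hi : (L.take i).length = i := by rw [List.length_take]; omega
    apply List.ext_getElem
    · rw [List.length_ofFn, List.length_append, hi, List.length_cons, List.length_drop]
      omega
    · intro j h1 h2
      simp only [List.length_ofFn] at h1
      rw [List.getElem_ofFn]
      simp only [Fin.lt_def, Fin.ext_iff]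
      rcases lt_trichotomy j i with hj | hj | hj
      · rw [if_pos hj, List.getElem_append_left (by omega), List.getElem_take, hget]
      · rw [if_neg (by omega), if_pos hj, List.getElem_append_right (by omega), List.getElem_cons,
          dif_pos (by omega)]
      · rw [if_neg (by omega), if_neg (by omega), List.getElem_append_right (by omega),
          List.getElem_cons, dif_neg (by omega), List.getElem_drop, hget]
        congr 2
        omega
  rw [e2, ← hL, isTrajectory_splits hc, ← e1]

theorem ofA_mul_ofA (x : V) (r r' : Δ.A x) : Δ.ofA x r * Δ.ofA x r' = Δ.ofA x (r * r') := by
  classical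
  refine TrivSqZeroExt.ext ?_ ?_
  · exact (Pi.single_mul (α := Δ.A) x r r').symm
  · simp [ofA]

theorem ofA_mul_ofA_ne {x y : V} (h : x ≠ y) (r : Δ.A x) (r' : Δ.A y) :
    Δ.ofA x r * Δ.ofA y r' = 0 := by
  classical
  refine TrivSqZeroExt.ext ?_ ?_
  · funext z
    change (Pi.single x r : Δ.Alg) z * (Pi.single y r' : Δ.Alg) z = 0
    by_cases hz : z = x
    · rw [Pi.single_eq_of_ne (M := Δ.A) (i := y) (i' := z) (by rintro rfl; exact h hz.symm),
        mul_zero]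
    · rw [Pi.single_eq_of_ne hz, zero_mul]
  · simp [ofA]

theorem ofA_mul_ofM (a : Total V) (r : Δ.A a.right) (m : Δ.M a.hom) :
    Δ.ofA a.right r * Δ.ofM a m = Δ.ofM a (r • m) := by
  classical
  refine (TrivSqZeroExt.inl_mul_inr _ _).trans (congrArg TrivSqZeroExt.inr (funext fun b => ?_))
  change (Pi.single a.right r : Δ.Alg) b.right •
    (Pi.single a m : ∀ b : Total V, Δ.M b.hom) b = (Pi.single a (r • m) : Δ.Bim) b
  by_cases hb : b = a
  · subst hb
    simp
  · rw [Pi.single_eq_of_ne hb, Pi.single_eq_of_ne hb, smul_zero]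

theorem ofA_mul_ofM_ne {x : V} {a : Total V} (h : x ≠ a.right) (r : Δ.A x) (m : Δ.M a.hom) :
    Δ.ofA x r * Δ.ofM a m = 0 := by
  classical
  refine (TrivSqZeroExt.inl_mul_inr _ _).trans ((congrArg TrivSqZeroExt.inr
    (funext fun b => ?_)).trans (TrivSqZeroExt.inr_zero _))
  change (Pi.single x r : Δ.Alg) b.right • (Pi.single a m : ∀ b : Total V, Δ.M b.hom) b = 0
  by_cases hb : b = a
  · subst hb
    rw [Pi.single_eq_of_ne (fun e => h e.symm), zero_smul]
  · rw [Pi.single_eq_of_ne hb, smul_zero]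

theorem ofM_mul_ofA (a : Total V) (r : Δ.A a.left) (m : Δ.M a.hom) :
    Δ.ofM a m * Δ.ofA a.left r = Δ.ofM a (MulOpposite.op r • m) := by
  classical
  refine (TrivSqZeroExt.inr_mul_inl _ _).trans (congrArg TrivSqZeroExt.inr (funext fun b => ?_))
  change MulOpposite.op ((Pi.single a.left r : Δ.Alg) b.left) •
    (Pi.single a m : ∀ b : Total V, Δ.M b.hom) b =
      (Pi.single a (MulOpposite.op r • m) : Δ.Bim) b
  by_cases hb : b = a
  · subst hb
    simp
  · rw [Pi.single_eq_of_ne hb, Pi.single_eq_of_ne hb, smul_zero]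

theorem ofM_mul_ofA_ne {x : V} {a : Total V} (h : x ≠ a.left) (r : Δ.A x) (m : Δ.M a.hom) :
    Δ.ofM a m * Δ.ofA x r = 0 := by
  classical
  refine (TrivSqZeroExt.inr_mul_inl _ _).trans ((congrArg TrivSqZeroExt.inr
    (funext fun b => ?_)).trans (TrivSqZeroExt.inr_zero _))
  change MulOpposite.op ((Pi.single x r : Δ.Alg) b.left) •
    (Pi.single a m : ∀ b : Total V, Δ.M b.hom) b = 0
  by_cases hb : b = a
  · subst hb
    rw [Pi.single_eq_of_ne (fun e => h e.symm), MulOpposite.op_zero, zero_smul]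
  · rw [Pi.single_eq_of_ne hb, smul_zero]

theorem ofM_mul_ofM (a b : Total V) (m : Δ.M a.hom) (m' : Δ.M b.hom) :
    Δ.ofM a m * Δ.ofM b m' = 0 :=
  TrivSqZeroExt.inr_mul_inr _ _ _

theorem proj_incl_self (c : Cell V) (v : Δ.Space c) : Δ.proj c (Δ.incl c v) = v := by
  classical
  cases c with
  | inl x => exact Pi.single_eq_same (M := Δ.A) x v
  | inr a => exact Pi.single_eq_same (M := fun b : Total V => Δ.M b.hom) a v

theorem proj_incl_ne {c c' : Cell V} (h : c ≠ c') (v : Δ.Space c') :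
    Δ.proj c (Δ.incl c' v) = 0 := by
  classical
  rcases c with x | a <;> rcases c' with x' | a'
  · exact Pi.single_eq_of_ne (M := Δ.A) (fun e => h (by rw [e])) v
  · rfl
  · rfl
  · exact Pi.single_eq_of_ne (M := fun b : Total V => Δ.M b.hom) (fun e => h (by rw [e])) v

theorem incl_mul_incl {c₁ c₂ : Cell V} (v₁ : Δ.Space c₁) (v₂ : Δ.Space c₂) :
    Δ.incl c₁ v₁ * Δ.incl c₂ v₂ = 0 ∨
      ∃ c, Splits c c₁ c₂ ∧ ∃ v, Δ.incl c₁ v₁ * Δ.incl c₂ v₂ = Δ.incl c v := by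
  rcases c₁ with x | a <;> rcases c₂ with y | b
  · by_cases h : x = y
    · subst h
      exact Or.inr ⟨_, .vertex x, _, Δ.ofA_mul_ofA x v₁ v₂⟩
    · exact Or.inl (Δ.ofA_mul_ofA_ne h v₁ v₂)
  · by_cases h : x = b.right
    · subst h
      exact Or.inr ⟨_, .left b, _, Δ.ofA_mul_ofM b v₁ v₂⟩
    · exact Or.inl (Δ.ofA_mul_ofM_ne h v₁ v₂)
  · by_cases h : y = a.left
    · subst h
      exact Or.inr ⟨_, .right a, _, Δ.ofM_mul_ofA a v₂ v₁⟩
    · exact Or.inl (Δ.ofM_mul_ofA_ne h v₂ v₁)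
  · exact Or.inl (Δ.ofM_mul_ofM a b v₁ v₂)

theorem e_mul_ofA (x : V) (r : Δ.A x) : Δ.e x * Δ.ofA x r = Δ.ofA x r := by
  rw [e, ofA_mul_ofA, one_mul]

theorem ofA_mul_e (x : V) (r : Δ.A x) : Δ.ofA x r * Δ.e x = Δ.ofA x r := by
  rw [e, ofA_mul_ofA, mul_one]

theorem e_mul_self (x : V) : Δ.e x * Δ.e x = Δ.e x := Δ.e_mul_ofA x 1

theorem corner_apply (y x : V) (z : Δ.Lam) : Δ.corner y x z = Δ.e y * z * Δ.e x := rfl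

theorem e_mul_of_mem {x y : V} {ω : Path x y} {z : Δ.Lam} (hz : z ∈ Δ.counterpart ω) :
    Δ.e y * z = z := by
  obtain ⟨u, rfl⟩ := hz
  rw [corner_apply, ← mul_assoc, ← mul_assoc, e_mul_self]

theorem mul_e_of_mem {x y : V} {ω : Path x y} {z : Δ.Lam} (hz : z ∈ Δ.counterpart ω) :
    z * Δ.e x = z := by
  obtain ⟨u, rfl⟩ := hz
  rw [corner_apply, mul_assoc, e_mul_self]

theorem corner_of_mem {x y : V} {ω : Path x y} {z : Δ.Lam} (hz : z ∈ Δ.counterpart ω) :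
    Δ.corner y x z = z := by
  rw [corner_apply, e_mul_of_mem Δ hz, mul_e_of_mem Δ hz]

/-- The sequence in `Λ_Δ` given by an element of the summand of `Λ_Δ^{⊗ n}` indexed by `σ`. -/
def word {n : ℕ} (σ : Fin n → Cell V) (v : ∀ i, Δ.Space (σ i)) : Fin n → Δ.Lam :=
  fun i => Δ.incl (σ i) (v i)

theorem component_apply {x y : V} (ω : Path x y) {n : ℕ} (g : HCochain k Δ.Lam n)
    (τ : Trajectory ω n) (v : ∀ i, Δ.Space (τ.1 i)) :
    (Δ.component ω n g τ v : Δ.Lam) = Δ.corner y x (g (Δ.word τ.1 v)) := rfl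

theorem contract_word {m n : ℕ} (h : m + 1 = n) (i : Fin m) (σ : Fin n → Cell V)
    (v : ∀ i, Δ.Space (σ i)) :
    contract h i (Δ.word σ v) i = 0 ∨ ∃ (τ : Fin m → Cell V) (u : ∀ i, Δ.Space (τ i)),
      contract h i (Δ.word σ v) = Δ.word τ u ∧
        ∀ {x y : V} (ω : Path x y), IsTrajectory ω (List.ofFn τ) ↔ IsTrajectory ω (List.ofFn σ) := by
  have hi : contract h i (Δ.word σ v) i =
      Δ.incl _ (v ⟨i, by omega⟩) * Δ.incl _ (v ⟨i + 1, by omega⟩) := by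
    simp only [contract, lt_self_iff_false, if_false, if_true]
    rfl
  rcases Δ.incl_mul_incl (v ⟨i, by omega⟩) (v ⟨i + 1, by omega⟩) with h0 | ⟨c, hc, w, hw⟩
  · exact Or.inl (hi.trans h0)
  · right
    obtain ⟨τ, hτ⟩ : ∃ τ : Fin m → Cell V, τ = fun j : Fin m => if j < i then σ ⟨j, by omega⟩
      else if j = i then c else σ ⟨j + 1, by omega⟩ := ⟨_, rfl⟩
    have key : ∀ j : Fin m, ∃ u : Δ.Space (τ j), contract h i (Δ.word σ v) j =
        Δ.incl (τ j) u := by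
      intro j
      by_cases h1 : j < i
      · have hj : τ j = σ ⟨j, by omega⟩ := by rw [hτ]; exact if_pos h1
        rw [hj, contract, if_pos h1]
        exact ⟨_, rfl⟩
      · by_cases h2 : j = i
        · have hj : τ j = c := by rw [hτ]; exact (if_neg h1).trans (if_pos h2)
          rw [hj, h2, hi]
          exact ⟨w, hw⟩
        · have hj : τ j = σ ⟨j + 1, by omega⟩ := by
            rw [hτ]; exact (if_neg h1).trans (if_neg h2)
          rw [hj, contract, if_neg h1, if_neg h2]
          exact ⟨_, rfl⟩
    choose u hu using key
    refine ⟨τ, u, funext hu, fun ω => ?_⟩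
    rw [hτ]
    exact isTrajectory_contract h σ i c hc ω

section Fin

variable [Finite V] [∀ x y : V, Subsingleton (x ⟶ y)]

theorem exists_eq_sum_incl (z : Δ.Lam) :
    letI := Fintype.ofFinite (Cell V)
    z = ∑ c : Cell V, Δ.incl c (Δ.proj c z) := by
  classical
  let i1 := Fintype.ofFinite V
  let i2 := Fintype.ofFinite (Total V)
  have hI : Fintype.ofFinite (Cell V) = instFintypeSum V (Total V) := Subsingleton.elim _ _
  rw [hI, Fintype.sum_sum_type]
  have h1 : ∑ x : V, Δ.incl (.inl x) (Δ.proj (.inl x) z) = TrivSqZeroExt.inl z.fst := by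
    have := congrArg Δ.inlLin (Finset.univ_sum_single (M := Δ.A) z.fst)
    rw [map_sum] at this
    exact this
  have h2 : ∑ a : Total V, Δ.incl (.inr a) (Δ.proj (.inr a) z) = TrivSqZeroExt.inr z.snd := by
    have h3 := congrArg Δ.inrLin
      (Finset.univ_sum_single (M := fun b : Total V => Δ.M b.hom) z.snd)
    exact (map_sum Δ.inrLin _ _).symm.trans h3
  rw [h1, h2, TrivSqZeroExt.inl_fst_add_inr_snd_eq]

/-- Multilinear maps are determined by their values on the summands of `Λ_Δ^{⊗ n}`. -/
theorem eq_of_word {n : ℕ} {W : Type*} [AddCommGroup W] [Module k W] (N : Δ.Lam →ₗ[k] W)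
    (f g : HCochain k Δ.Lam n)
    (h : ∀ σ (v : ∀ i, Δ.Space (σ i)), N (f (Δ.word σ v)) = N (g (Δ.word σ v)))
    (x : Fin n → Δ.Lam) : N (f x) = N (g x) := by
  classical
  let _ := Fintype.ofFinite (Cell V)
  have hx : x = fun i => ∑ c : Cell V, Δ.incl c (Δ.proj c (x i)) :=
    funext fun i => Δ.exists_eq_sum_incl (x i)
  rw [hx, MultilinearMap.map_sum, MultilinearMap.map_sum, map_sum, map_sum]
  exact Finset.sum_congr rfl fun σ _ => h σ fun i => Δ.proj (σ i) (x i)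

theorem extend_word {x y : V} (ω : Path x y) {n : ℕ} (f : Δ.KCochain ω n) (σ : Fin n → Cell V)
    (hσ : IsTrajectory ω (List.ofFn σ)) (v : ∀ i, Δ.Space (σ i)) :
    Δ.extend ω n f (Δ.word σ v) = (f ⟨σ, hσ⟩ v : Δ.Lam) := by
  have : Δ.extend ω n f (Δ.word σ v) = ∑ τ : Trajectory ω n,
      (f τ (fun i => Δ.proj (τ.1 i) (Δ.incl (σ i) (v i))) : Δ.Lam) := by
    change (∑ τ : Trajectory ω n, (Δ.counterpart ω).subtype.compMultilinearMap
      ((f τ).compLinearMap fun i => Δ.proj (τ.1 i))) (Δ.word σ v) = _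
    rw [sum_apply]
    rfl
  rw [this, Finset.sum_eq_single (⟨σ, hσ⟩ : Trajectory ω n)]
  · simp only [proj_incl_self]
  · intro τ _ hτ
    obtain ⟨i, hi⟩ : ∃ i, τ.1 i ≠ σ i := by
      by_contra hc
      push Not at hc
      exact hτ (Subtype.ext (funext hc))
    rw [(f τ).map_coord_zero i (Δ.proj_incl_ne hi (v i))]
    rfl
  · intro hn
    exact absurd (Finset.mem_univ _) hn

theorem extend_word_of_not {x y : V} (ω : Path x y) {n : ℕ} (f : Δ.KCochain ω n)
    (σ : Fin n → Cell V) (hσ : ¬ IsTrajectory ω (List.ofFn σ)) (v : ∀ i, Δ.Space (σ i)) :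
    Δ.extend ω n f (Δ.word σ v) = 0 := by
  change (∑ τ : Trajectory ω n, (Δ.counterpart ω).subtype.compMultilinearMap
      ((f τ).compLinearMap fun i => Δ.proj (τ.1 i))) (Δ.word σ v) = _
  rw [sum_apply]
  refine Finset.sum_eq_zero fun τ _ => ?_
  obtain ⟨i, hi⟩ : ∃ i, τ.1 i ≠ σ i := by
    by_contra hc
    push Not at hc
    have := τ.2
    rw [show τ.1 = σ from funext hc] at this
    exact hσ this
  change ((f τ (fun i => Δ.proj (τ.1 i) (Δ.incl (σ i) (v i))) : Δ.counterpart ω) : Δ.Lam) = 0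
  rw [(f τ).map_coord_zero i (Δ.proj_incl_ne hi (v i))]
  rfl

theorem extend_mem {x y : V} (ω : Path x y) {n : ℕ} (f : Δ.KCochain ω n) (z : Fin n → Δ.Lam) :
    Δ.extend ω n f z ∈ Δ.counterpart ω := by
  change (∑ τ : Trajectory ω n, (Δ.counterpart ω).subtype.compMultilinearMap
      ((f τ).compLinearMap fun i => Δ.proj (τ.1 i))) z ∈ _
  rw [sum_apply]
  exact Submodule.sum_mem _ fun τ _ => SetLike.coe_mem _

end Fin

theorem fst_eq (z : Δ.Lam) : z.fst = Δ.fstLin z := rfl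

theorem fst_ofM (a : Total V) (m : Δ.M a.hom) : (Δ.ofM a m).fst = 0 := rfl

theorem fst_mul_of_left {z : Δ.Lam} (hz : z.fst = 0) (w : Δ.Lam) : (z * w).fst = 0 := by
  rw [TrivSqZeroExt.fst_mul, hz, zero_mul]

theorem fst_mul_of_right {z : Δ.Lam} (hz : z.fst = 0) (w : Δ.Lam) : (w * z).fst = 0 := by
  rw [TrivSqZeroExt.fst_mul, hz, mul_zero]

theorem mul_eq_zero_of_fst {z w : Δ.Lam} (hz : z.fst = 0) (hw : w.fst = 0) : z * w = 0 := by
  refine TrivSqZeroExt.ext ?_ ?_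
  · rw [TrivSqZeroExt.fst_mul, hz, zero_mul, TrivSqZeroExt.fst_zero]
  · rw [TrivSqZeroExt.snd_mul, hz, hw, MulOpposite.op_zero, zero_smul, zero_smul, add_zero,
      TrivSqZeroExt.snd_zero]

theorem fst_of_mem_counterpart {x y : V} (hxy : x ≠ y) {ω : Path x y} {z : Δ.Lam}
    (hz : z ∈ Δ.counterpart ω) : z.fst = 0 := by
  classical
  have h : z.fst = (Δ.e y).fst * z.fst * (Δ.e x).fst := by
    conv_lhs => rw [← Δ.corner_of_mem hz]
    rw [corner_apply, TrivSqZeroExt.fst_mul, TrivSqZeroExt.fst_mul]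
  rw [h]
  funext v
  change (Pi.single y (1 : Δ.A y) : Δ.Alg) v * z.fst v * (Pi.single x (1 : Δ.A x) : Δ.Alg) v = 0
  by_cases hv : v = y
  · rw [Pi.single_eq_of_ne (M := Δ.A) (i := x) (i' := v) (by rintro rfl; exact hxy hv), mul_zero]
  · rw [Pi.single_eq_of_ne hv, zero_mul, zero_mul]

theorem corner_eq_zero [∀ x : V, IsEmpty (x ⟶ x)] (x : V) {z : Δ.Lam} (hz : z.fst = 0) :
    Δ.corner x x z = 0 := by
  classical
  refine TrivSqZeroExt.ext ?_ ?_
  · rw [corner_apply, fst_mul_of_left Δ (fst_mul_of_right Δ hz _), TrivSqZeroExt.fst_zero]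
  · rw [corner_apply, TrivSqZeroExt.snd_mul, fst_mul_of_right Δ hz, zero_smul, zero_add,
      TrivSqZeroExt.snd_mul, hz, MulOpposite.op_zero, zero_smul, add_zero]
    funext a
    rw [op_smul_apply, smul_apply]
    change MulOpposite.op ((Pi.single x (1 : Δ.A x) : Δ.Alg) a.left) •
      (Pi.single x (1 : Δ.A x) : Δ.Alg) a.right • z.snd a = 0
    by_cases h1 : a.left = x
    · by_cases h2 : a.right = x
      · obtain ⟨l, r, f⟩ := a
        simp only at h1 h2
        subst h1
        subst h2
        exact isEmptyElim f
      · rw [Pi.single_eq_of_ne h2, zero_smul, smul_zero]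
    · rw [Pi.single_eq_of_ne h1, MulOpposite.op_zero, zero_smul]

theorem component_congr [∀ x : V, IsEmpty (x ⟶ x)] {x : V} (γ : Path x x) {n : ℕ}
    {g g' : HCochain k Δ.Lam n} (h : ∀ z, (g z).fst = (g' z).fst) :
    Δ.component γ n g = Δ.component γ n g' := by
  funext τ
  refine MultilinearMap.ext fun v => Subtype.ext ?_
  rw [component_apply, component_apply, ← sub_eq_zero, ← map_sub]
  exact Δ.corner_eq_zero x (by rw [TrivSqZeroExt.fst_sub, h, sub_self])

theorem incl_mul_of_mem {x y : V} {ω : Path x y} {w : Δ.Lam} (hw : w ∈ Δ.counterpart ω)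
    (c : Cell V) (u : Δ.Space c) :
    (c = .inl y ∧ Δ.corner y x (Δ.incl c u * w) = Δ.incl c u * w) ∨ Δ.incl c u * w = 0 ∨
      (Δ.incl c u).fst = 0 := by
  rcases c with z | a
  · by_cases hz : z = y
    · subst hz
      refine Or.inl ⟨rfl, ?_⟩
      rw [corner_apply, ← mul_assoc, mul_assoc, mul_e_of_mem Δ hw]
      exact congrArg (· * w) (Δ.e_mul_ofA z u)
    · refine Or.inr (Or.inl ?_)
      rw [← e_mul_of_mem Δ hw, ← mul_assoc]
      have : Δ.incl (.inl z) u * Δ.e y = 0 := Δ.ofA_mul_ofA_ne hz u 1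
      rw [this, zero_mul]
  · exact Or.inr (Or.inr rfl)

theorem mul_incl_of_mem {x y : V} {ω : Path x y} {w : Δ.Lam} (hw : w ∈ Δ.counterpart ω)
    (c : Cell V) (u : Δ.Space c) :
    (c = .inl x ∧ Δ.corner y x (w * Δ.incl c u) = w * Δ.incl c u) ∨ w * Δ.incl c u = 0 ∨
      (Δ.incl c u).fst = 0 := by
  rcases c with z | a
  · by_cases hz : z = x
    · subst hz
      refine Or.inl ⟨rfl, ?_⟩
      rw [corner_apply, ← mul_assoc, mul_assoc, e_mul_of_mem Δ hw]
      exact congrArg (w * ·) (Δ.ofA_mul_e z u)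
    · refine Or.inr (Or.inl ?_)
      rw [← mul_e_of_mem Δ hw, mul_assoc]
      have : Δ.e x * Δ.incl (.inl z) u = 0 := Δ.ofA_mul_ofA_ne (fun e => hz e.symm) 1 u
      rw [this, mul_zero]
  · exact Or.inr (Or.inr rfl)

section Fin

variable [Finite V] [∀ x y : V, Subsingleton (x ⟶ y)]

theorem map_hd_extend {x y : V} (ω : Path x y) {W : Type*} [AddCommGroup W] [Module k W]
    (N : Δ.Lam →ₗ[k] W)
    (hN : ∀ z w : Δ.Lam, z.fst = 0 → w ∈ Δ.counterpart ω → N (z * w) = 0 ∧ N (w * z) = 0)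
    {m n : ℕ} (h : m + 1 = n) (f : Δ.KCochain ω m) (X : Fin n → Δ.Lam) :
    N (hd m n h (Δ.extend ω m f) X) = N (Δ.extend ω n (Δ.kd ω m n h f) X) := by
  refine Δ.eq_of_word N _ _ (fun σ v => ?_) X
  obtain ⟨g, hg⟩ : ∃ g, g = Δ.extend ω m f := ⟨_, rfl⟩
  have hmem : ∀ z, g z ∈ Δ.counterpart ω := fun z => by rw [hg]; exact Δ.extend_mem ω f z
  -- the three kinds of terms of the coboundary
  have t1 : (IsTrajectory ω (List.ofFn σ) →
        N (Δ.corner y x (Δ.incl _ (v ⟨0, by omega⟩) * g (slice 1 m (by omega) (Δ.word σ v)))) =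
          N (Δ.incl _ (v ⟨0, by omega⟩) * g (slice 1 m (by omega) (Δ.word σ v)))) ∧
      (¬ IsTrajectory ω (List.ofFn σ) →
        N (Δ.incl _ (v ⟨0, by omega⟩) * g (slice 1 m (by omega) (Δ.word σ v))) = 0) := by
    by_cases ht : IsTrajectory ω (List.ofFn (slice 1 m (by omega) σ))
    · rcases Δ.incl_mul_of_mem (hmem (slice 1 m (by omega) (Δ.word σ v))) _ (v ⟨0, by omega⟩) with
        ⟨h1, h2⟩ | h1 | h1
      · refine ⟨fun _ => by rw [h2], fun hn => absurd ?_ hn⟩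
        rw [ofFn_cons_slice h, h1, isTrajectory_cons_inl]
        exact ⟨rfl, ht⟩
      · rw [h1]
        simp
      · have h2 := (hN _ _ h1 (hmem (slice 1 m (by omega) (Δ.word σ v)))).1
        refine ⟨fun _ => ?_, fun _ => h2⟩
        rw [h2, corner_apply, ← mul_assoc, mul_assoc, mul_e_of_mem Δ (hmem _)]
        exact (hN _ _ (Δ.fst_mul_of_right h1 _) (hmem _)).1
    · have h0 : g (slice 1 m (by omega) (Δ.word σ v)) = 0 := by
        rw [hg]
        exact Δ.extend_word_of_not ω f _ ht fun j => v _
      rw [h0, mul_zero]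
      simp
  have t3 : (IsTrajectory ω (List.ofFn σ) →
        N (Δ.corner y x (g (slice 0 m (by omega) (Δ.word σ v)) * Δ.incl _ (v ⟨m, by omega⟩))) =
          N (g (slice 0 m (by omega) (Δ.word σ v)) * Δ.incl _ (v ⟨m, by omega⟩))) ∧
      (¬ IsTrajectory ω (List.ofFn σ) →
        N (g (slice 0 m (by omega) (Δ.word σ v)) * Δ.incl _ (v ⟨m, by omega⟩)) = 0) := by
    by_cases ht : IsTrajectory ω (List.ofFn (slice 0 m (by omega) σ))
    · rcases Δ.mul_incl_of_mem (hmem (slice 0 m (by omega) (Δ.word σ v))) _ (v ⟨m, by omega⟩) with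
        ⟨h1, h2⟩ | h1 | h1
      · refine ⟨fun _ => by rw [h2], fun hn => absurd ?_ hn⟩
        rw [ofFn_slice_append h, h1, isTrajectory_append_inl]
        exact ⟨rfl, ht⟩
      · rw [h1]
        simp
      · have h2 := (hN _ _ h1 (hmem (slice 0 m (by omega) (Δ.word σ v)))).2
        refine ⟨fun _ => ?_, fun _ => h2⟩
        rw [h2, corner_apply, ← mul_assoc, mul_assoc, e_mul_of_mem Δ (hmem _)]
        exact (hN _ _ (Δ.fst_mul_of_left h1 _) (hmem _)).2
    · have h0 : g (slice 0 m (by omega) (Δ.word σ v)) = 0 := by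
        rw [hg]
        exact Δ.extend_word_of_not ω f _ ht fun j => v _
      rw [h0, zero_mul]
      simp
  have t2 : ∀ i : Fin m, (IsTrajectory ω (List.ofFn σ) →
        Δ.corner y x (g (contract h i (Δ.word σ v))) = g (contract h i (Δ.word σ v))) ∧
      (¬ IsTrajectory ω (List.ofFn σ) → g (contract h i (Δ.word σ v)) = 0) := by
    intro i
    refine ⟨fun _ => Δ.corner_of_mem (hmem _), fun hn => ?_⟩
    rcases Δ.contract_word h i σ v with h0 | ⟨τ, u, h1, h2⟩
    · exact g.map_coord_zero i h0
    · rw [h1, hg]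
      exact Δ.extend_word_of_not ω f τ (fun ht => hn ((h2 ω).1 ht)) u
  by_cases hσ : IsTrajectory ω (List.ofFn σ)
  · rw [Δ.extend_word ω _ σ hσ]
    change N (hd m n h (Δ.extend ω m f) (Δ.word σ v)) =
      N (Δ.corner y x (hd m n h (Δ.extend ω m f) (Δ.word σ v)))
    rw [← hg, hd_apply]
    simp only [map_add, map_sum, map_smul]
    refine congrArg₂ (· + ·) (congrArg₂ (· + ·) (t1.1 hσ).symm ?_)
      (congrArg (_ • ·) (t3.1 hσ).symm)
    exact Finset.sum_congr rfl fun i _ => by rw [(t2 i).1 hσ]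
  · rw [Δ.extend_word_of_not ω _ σ hσ, map_zero, ← hg, hd_apply]
    simp only [map_add, map_sum, map_smul]
    have e1 := t1.2 hσ
    have e3 := t3.2 hσ
    change N (Δ.incl _ (v ⟨0, by omega⟩) * _) + _ + _ • N (_ * Δ.incl _ (v ⟨m, by omega⟩)) = 0
    rw [e1, e3, smul_zero, add_zero, zero_add]
    exact Finset.sum_eq_zero fun i _ => by rw [(t2 i).2 hσ, map_zero, smul_zero]

theorem extend_kd {x y : V} (hxy : x ≠ y) (ω : Path x y) (m n : ℕ) (h : m + 1 = n)
    (f : Δ.KCochain ω m) :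
    Δ.extend ω n (Δ.kd ω m n h f) = hd m n h (Δ.extend ω m f) := by
  refine MultilinearMap.ext fun X => (Δ.map_hd_extend ω LinearMap.id (fun z w hz hw => ?_) h f X).symm
  have hw' := Δ.fst_of_mem_counterpart hxy hw
  exact ⟨Δ.mul_eq_zero_of_fst hz hw', Δ.mul_eq_zero_of_fst hw' hz⟩

theorem fst_hd_extend {x y : V} (ω : Path x y) {m n : ℕ} (h : m + 1 = n) (f : Δ.KCochain ω m)
    (X : Fin n → Δ.Lam) :
    (hd m n h (Δ.extend ω m f) X).fst = (Δ.extend ω n (Δ.kd ω m n h f) X).fst :=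
  Δ.map_hd_extend ω Δ.fstLin
    (fun _ w hz _ => ⟨Δ.fst_mul_of_left hz w, Δ.fst_mul_of_right hz w⟩) h f X

variable [∀ x : V, IsEmpty (x ⟶ x)]

theorem component_hd {x : V} (γ : Path x x) (m n : ℕ) (h : m + 1 = n) (g : HCochain k Δ.Lam m) :
    Δ.component γ n (hd m n h g) = Δ.kd γ m n h (Δ.component γ m g) := by
  funext ⟨σ, hσ⟩
  refine MultilinearMap.ext fun v => Subtype.ext ?_
  obtain ⟨g', hg'⟩ : ∃ g', g' = Δ.extend γ m (Δ.component γ m g) := ⟨_, rfl⟩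
  change Δ.corner x x (hd m n h g (Δ.word σ v)) =
    Δ.corner x x (hd m n h (Δ.extend γ m (Δ.component γ m g)) (Δ.word σ v))
  have hw : ∀ (τ : Fin m → Cell V) (u : ∀ i, Δ.Space (τ i)), IsTrajectory γ (List.ofFn τ) →
      g' (Δ.word τ u) = Δ.corner x x (g (Δ.word τ u)) := by
    intro τ u hτ
    rw [hg', Δ.extend_word γ _ τ hτ]
    rfl
  rw [← hg', hd_apply, hd_apply]
  simp only [map_add, map_sum, map_smul]
  refine congrArg₂ (· + ·) (congrArg₂ (· + ·) ?_ (Finset.sum_congr rfl fun i _ => ?_))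
    (congrArg (_ • ·) ?_)
  · have hlt : 0 < n := by omega
    have hσ' := hσ
    rw [ofFn_cons_slice h] at hσ'
    change Δ.corner x x (Δ.incl (σ ⟨0, hlt⟩) (v ⟨0, hlt⟩) * _) =
      Δ.corner x x (Δ.incl (σ ⟨0, hlt⟩) (v ⟨0, hlt⟩) * _)
    obtain ⟨u, hu⟩ : ∃ u : Δ.Space (σ ⟨0, hlt⟩), u = v ⟨0, hlt⟩ := ⟨_, rfl⟩
    rw [← hu]
    clear hu
    revert hσ' u
    generalize σ ⟨0, hlt⟩ = c
    intro hσ' u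
    rcases c with z | a
    · rw [isTrajectory_cons_inl] at hσ'
      obtain ⟨rfl, ht⟩ := hσ'
      have h1 : g' (slice 1 m (by omega) (Δ.word σ v)) =
          Δ.corner z z (g (slice 1 m (by omega) (Δ.word σ v))) := hw _ (fun j => v _) ht
      have h2 : Δ.incl (.inl z) u * Δ.e z = Δ.incl (.inl z) u := Δ.ofA_mul_e z u
      rw [h1]
      simp only [corner_apply]
      rw [mul_assoc (Δ.e z), mul_assoc (Δ.e z), ← mul_assoc (Δ.incl _ u), ← mul_assoc (Δ.incl _ u),
        h2]
      simp only [mul_assoc, e_mul_self]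
    · have h0 : (Δ.incl (.inr a) u).fst = 0 := Δ.fst_ofM a u
      rw [Δ.corner_eq_zero x (Δ.fst_mul_of_left h0 _),
        Δ.corner_eq_zero x (Δ.fst_mul_of_left h0 _)]
  · congr 1
    rcases Δ.contract_word h i σ v with h0 | ⟨τ, u, h1, h2⟩
    · rw [g.map_coord_zero i h0, g'.map_coord_zero i h0]
    · rw [h1, hw τ u ((h2 γ).2 hσ)]
      exact (Δ.corner_of_mem (ω := γ) ⟨_, rfl⟩).symm
  · have hlt : m < n := by omega
    have hσ' := hσ
    rw [ofFn_slice_append h] at hσ'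
    change Δ.corner x x (_ * Δ.incl (σ ⟨m, hlt⟩) (v ⟨m, hlt⟩)) =
      Δ.corner x x (_ * Δ.incl (σ ⟨m, hlt⟩) (v ⟨m, hlt⟩))
    obtain ⟨u, hu⟩ : ∃ u : Δ.Space (σ ⟨m, hlt⟩), u = v ⟨m, hlt⟩ := ⟨_, rfl⟩
    rw [← hu]
    clear hu
    revert hσ' u
    generalize σ ⟨m, hlt⟩ = c
    intro hσ' u
    rcases c with z | a
    · rw [isTrajectory_append_inl] at hσ'
      obtain ⟨rfl, ht⟩ := hσ'
      have h1 : g' (slice 0 m (by omega) (Δ.word σ v)) =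
          Δ.corner z z (g (slice 0 m (by omega) (Δ.word σ v))) := hw _ (fun j => v _) ht
      have h2 : Δ.e z * Δ.incl (.inl z) u = Δ.incl (.inl z) u := Δ.e_mul_ofA z u
      rw [h1]
      simp only [corner_apply]
      simp only [mul_assoc]
      rw [← mul_assoc (Δ.e z) (Δ.incl _ u), h2, ← mul_assoc (Δ.e z) (Δ.e z), e_mul_self]
    · have h0 : (Δ.incl (.inr a) u).fst = 0 := Δ.fst_ofM a u
      rw [Δ.corner_eq_zero x (Δ.fst_mul_of_right h0 _),
        Δ.corner_eq_zero x (Δ.fst_mul_of_right h0 _)]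

/-- The cup product along paths of cochains `f'` along `ω'` and `f` along `ω`, for `ω'` following
`ω`: on a trajectory over `ω' ω` that is the concatenation of trajectories `τ'` over `ω'` and `τ`
over `ω`, it is `f'_{τ'} ⊗ f_τ` followed by the product of `Λ_Δ`; it is zero on the others. -/
def kcup {x y z : V} (ω' : Path y z) (ω : Path x y) (p q n : ℕ) (h : p + q = n) :
    Δ.KCochain ω' p →ₗ[k] Δ.KCochain ω q →ₗ[k] Δ.KCochain (ω.comp ω') n :=
  ((cup p q n h).compl₁₂ (Δ.extend ω' p) (Δ.extend ω q)).compr₂ (Δ.component (ω.comp ω') n)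

theorem kd_kcup {x : V} (γ' γ : Path x x) (p q n : ℕ) (h : p + q = n)
    (f : Δ.KCochain γ' p) (g : Δ.KCochain γ q) :
    Δ.kd (γ.comp γ') n (n + 1) rfl (Δ.kcup γ' γ p q n h f g) =
      Δ.kcup γ' γ (p + 1) q (n + 1) (by omega) (Δ.kd γ' p (p + 1) rfl f) g +
        (-1 : k) ^ p •
          Δ.kcup γ' γ p (q + 1) (n + 1) (by omega) f (Δ.kd γ q (q + 1) rfl g) := by
  change Δ.kd (γ.comp γ') n (n + 1) rfl
      (Δ.component (γ.comp γ') n (cup p q n h (Δ.extend γ' p f) (Δ.extend γ q g))) =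
    Δ.component (γ.comp γ') (n + 1) (cup (p + 1) q (n + 1) (by omega)
        (Δ.extend γ' (p + 1) (Δ.kd γ' p (p + 1) rfl f)) (Δ.extend γ q g)) +
      (-1 : k) ^ p • Δ.component (γ.comp γ') (n + 1) (cup p (q + 1) (n + 1) (by omega)
        (Δ.extend γ' p f) (Δ.extend γ (q + 1) (Δ.kd γ q (q + 1) rfl g)))
  rw [← component_hd, hd_cup, map_add, map_smul]
  refine congrArg₂ (· + ·) ?_ (congrArg (_ • ·) ?_)
  · refine Δ.component_congr _ fun z => ?_
    rw [cup_apply, cup_apply, TrivSqZeroExt.fst_mul, TrivSqZeroExt.fst_mul, fst_hd_extend]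
  · refine Δ.component_congr _ fun z => ?_
    rw [cup_apply, cup_apply, TrivSqZeroExt.fst_mul, TrivSqZeroExt.fst_mul, fst_hd_extend]

/-- The cohomology `H^n_ω(Δ)` along the path `ω`. -/
abbrev KH {x y : V} (ω : Path x y) (n : ℕ) : Type _ := Cohomology (X := Δ.KCochain ω) (Δ.kd ω) n

end Fin

end QSet

/-- The paths of length at most `n` that are not cycles, that is whose source and target differ. -/
structure NonCycle (V : Type*) [Quiver V] (n : ℕ) where
  source : V
  target : V
  path : Path source target
  ne : source ≠ target
  length_le : path.length ≤ n

/-- The cycles of length at most `n`, vertices included: the paths of length at most `n` whose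
source and target coincide. -/
structure Cycle (V : Type*) [Quiver V] (n : ℕ) where
  vertex : V
  path : Path vertex vertex
  length_le : path.length ≤ n

/-- The cycles of length at most `n` that are not vertices. -/
structure PosCycle (V : Type*) [Quiver V] (n : ℕ) extends Cycle V n where
  length_pos : 0 < path.length

theorem finite_paths (V : Type*) [Quiver V] [Finite V] [∀ x y : V, Subsingleton (x ⟶ y)] (n : ℕ) :
    Finite {ω : Σ x y : V, Path x y // ω.2.2.length ≤ n} := by
  induction n with
  | zero =>
    refine Finite.of_injective (fun ω => ω.1.1) ?_
    rintro ⟨⟨x, y, ω⟩, h⟩ ⟨⟨x', y', ω'⟩, h'⟩ (rfl : x = x')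
    cases ω with
    | nil =>
      cases ω' with
      | nil => rfl
      | cons _ _ => simp at h'
    | cons _ _ => simp at h
  | succ n ih =>
    let F : {ω : Σ x y : V, Path x y // ω.2.2.length ≤ n + 1} →
        V ⊕ ({ω : Σ x y : V, Path x y // ω.2.2.length ≤ n} × V) := fun ω =>
      match ω with
      | ⟨⟨x, _, .nil⟩, _⟩ => .inl x
      | ⟨⟨x, y, .cons ω _⟩, h⟩ => .inr (⟨⟨x, _, ω⟩, Nat.le_of_succ_le_succ h⟩, y)
    refine Finite.of_injective F ?_
    rintro ⟨⟨x, y, ω⟩, h⟩ ⟨⟨x', y', ω'⟩, h'⟩ he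
    cases ω with
    | nil =>
      cases ω' with
      | nil => cases he; rfl
      | cons _ _ => cases he
    | cons ω a =>
      cases ω' with
      | nil => cases he
      | cons ω' a' =>
        cases he
        obtain rfl := Subsingleton.elim a a'
        rfl

instance (V : Type*) [Quiver V] [Finite V] [∀ x y : V, Subsingleton (x ⟶ y)] (n : ℕ) :
    Finite (PosCycle V n) := by
  have := finite_paths V n
  refine Finite.of_injective (β := {ω : Σ x y : V, Path x y // ω.2.2.length ≤ n})
    (fun γ => ⟨⟨γ.vertex, γ.vertex, γ.path⟩, γ.length_le⟩) ?_
  rintro ⟨⟨x, γ, h⟩, h0⟩ ⟨⟨x', γ', h'⟩, h0'⟩ he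
  cases he
  rfl

namespace QSet

variable (Δ : QSet k V)

/-- The restriction of a cochain of `Λ_Δ` to `A`, followed by the projection of `Λ_Δ` to `A`. -/
def restrictAlg (n : ℕ) : HCochain k Δ.Lam n →ₗ[k] HCochain k Δ.Alg n where
  toFun g := Δ.fstLin.compMultilinearMap (g.compLinearMap fun _ => Δ.inlLin)
  map_add' _ _ := rfl
  map_smul' _ _ := rfl

/-- A cochain of `A` as a cochain of `Λ_Δ`, through the projection of `Λ_Δ` to `A` and the
inclusion of `A` in `Λ_Δ`. -/
def inflateAlg (n : ℕ) : HCochain k Δ.Alg n →ₗ[k] HCochain k Δ.Lam n where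
  toFun g := Δ.inlLin.compMultilinearMap (g.compLinearMap fun _ => Δ.fstLin)
  map_add' _ _ := MultilinearMap.ext fun _ => map_add Δ.inlLin _ _
  map_smul' c _ := MultilinearMap.ext fun _ => map_smul Δ.inlLin c _

theorem restrictAlg_hd (m n : ℕ) (h : m + 1 = n) (g : HCochain k Δ.Lam m) :
    Δ.restrictAlg n (hd m n h g) = hd m n h (Δ.restrictAlg m g) := by
  refine MultilinearMap.ext fun x => ?_
  change (hd m n h g fun i => Δ.inlLin (x i)).fst = _
  have hc : ∀ i : Fin m, contract h i (fun i => Δ.inlLin (x i)) =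
      fun j => Δ.inlLin (contract h i x j) := by
    intro i
    funext j
    simp only [contract]
    split_ifs
    · rfl
    · exact (map_mul (TrivSqZeroExt.inlAlgHom k Δ.Alg Δ.Bim) _ _).symm
    · rfl
  rw [hd_apply, hd_apply]
  simp only [hc]
  rw [fst_eq]
  simp only [map_add, map_sum, map_smul]
  rfl

theorem fst_inflateAlg_hd (m n : ℕ) (h : m + 1 = n) (g : HCochain k Δ.Alg m)
    (z : Fin n → Δ.Lam) :
    (Δ.inflateAlg n (hd m n h g) z).fst = (hd m n h (Δ.inflateAlg m g) z).fst := by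
  change hd m n h g (fun i => Δ.fstLin (z i)) = _
  have hc : ∀ i : Fin m, contract h i (fun i => Δ.fstLin (z i)) =
      fun j => Δ.fstLin (contract h i z j) := by
    intro i
    funext j
    simp only [contract]
    split_ifs
    · rfl
    · exact (map_mul (TrivSqZeroExt.fstHom k Δ.Alg Δ.Bim) _ _).symm
    · rfl
  rw [hd_apply, hd_apply]
  simp only [hc]
  rw [fst_eq]
  simp only [map_add, map_sum, map_smul]
  rfl

section Maps

variable [Finite V] [∀ x y : V, Subsingleton (x ⟶ y)]

/-- The subspace `D^n` of the cochains that are sums of cochains along paths which are not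
cycles. -/
def nonCycleCochains (n : ℕ) : Submodule k (HCochain k Δ.Lam n) :=
  ⨆ δ : NonCycle V n, LinearMap.range (Δ.extend δ.path n)

open scoped Classical in
/-- The map `⊕_δ H^n_δ(Δ) → HH^n(Λ_Δ)`, over the paths `δ` of length at most `n` that are not
cycles, induced by the inclusions of the complexes `K_δ` in the Hochschild complex. -/
def fromNonCycles (n : ℕ) : (⨁ δ : NonCycle V n, Δ.KH δ.path n) →ₗ[k] HH k Δ.Lam n :=
  DirectSum.toModule k _ _ fun δ =>
    Cohomology.map (X := Δ.KCochain δ.path) (Y := HCochain k Δ.Lam) (Δ.kd δ.path) hd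
      (Δ.extend δ.path) (Δ.extend_kd δ.ne δ.path) n

/-- The map `HH^n(Λ_Δ) → HH^n(A)`. -/
def toAlg (n : ℕ) : HH k Δ.Lam n →ₗ[k] HH k Δ.Alg n :=
  Cohomology.map (X := HCochain k Δ.Lam) (Y := HCochain k Δ.Alg) hd hd Δ.restrictAlg
    Δ.restrictAlg_hd n

variable [∀ x : V, IsEmpty (x ⟶ x)]

/-- The map `HH^n(Λ_Δ) → H^n_γ(Δ)` that takes the component along the cycle `γ`. -/
def toCycle {x : V} (γ : Path x x) (n : ℕ) : HH k Δ.Lam n →ₗ[k] Δ.KH γ n :=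
  Cohomology.map (X := HCochain k Δ.Lam) (Y := Δ.KCochain γ) hd (Δ.kd γ) (Δ.component γ)
    (Δ.component_hd γ) n

/-- The map `HH^n(A) → H^n_x(Δ)` that takes the component along the vertex `x`. Together, these
maps are the identification of `HH^n(A)` with `⊕_x H^n_x(Δ)`. -/
def toVertex (x : V) (n : ℕ) : HH k Δ.Alg n →ₗ[k] Δ.KH (.nil : Path x x) n :=
  Cohomology.map (X := HCochain k Δ.Alg) (Y := Δ.KCochain (.nil : Path x x)) hd (Δ.kd .nil)
    (fun n => Δ.component .nil n ∘ₗ Δ.inflateAlg n)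
    (fun m n h g => by
      rw [LinearMap.comp_apply, LinearMap.comp_apply, ← component_hd]
      exact Δ.component_congr _ (Δ.fst_inflateAlg_hd m n h g)) n

/-- The cup product `H^p_{γ'}(Δ) ⊗ H^q_γ(Δ) → H^{p+q}_{γ' γ}(Δ)` for cycles at the same vertex. -/
def KH.cup {x : V} (γ' γ : Path x x) (p q : ℕ) :
    Δ.KH γ' p →ₗ[k] Δ.KH γ q →ₗ[k] Δ.KH (γ.comp γ') (p + q) :=
  Cohomology.pairing (X := Δ.KCochain γ') (Y := Δ.KCochain γ) (Z := Δ.KCochain (γ.comp γ'))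
    (Δ.kd γ') (Δ.kd γ) (Δ.kd (γ.comp γ')) (Δ.kcup γ' γ) (Δ.kd_kcup γ' γ) p q

/-- The cohomology along all the cycles, vertices included: `⊕_γ H^n_γ(Δ)`. -/
abbrev CycleCoh (n : ℕ) : Type _ := ⨁ γ : Cycle V n, Δ.KH γ.path n

/-- The cohomology along the cycles that are not vertices. -/
abbrev PosCycleCoh (n : ℕ) : Type _ := ⨁ γ : PosCycle V n, Δ.KH γ.path n

open scoped Classical in
/-- The cup product of the cohomologies along two cycles: it lands in the cohomology along the
concatenated cycle, and it is zero if the cycles do not have the same base vertex. -/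
def cycleCupAux (p q : ℕ) :
    ∀ (γ' : Cycle V p) (γ : Cycle V q), Δ.KH γ'.path p →ₗ[k] Δ.KH γ.path q →ₗ[k] Δ.CycleCoh (p + q)
  | ⟨x, γ', h'⟩, ⟨y, γ, h⟩ =>
    if e : x = y then by
      subst e
      exact (KH.cup Δ γ' γ p q).compr₂ (DirectSum.lof k (Cycle V (p + q))
        (fun β => Δ.KH β.path (p + q))
        ⟨x, γ.comp γ', by rw [Path.length_comp]; omega⟩)
    else 0

open scoped Classical in
/-- The cup product of the cohomology along cycles. -/
def cycleCup (p q : ℕ) : Δ.CycleCoh p →ₗ[k] Δ.CycleCoh q →ₗ[k] Δ.CycleCoh (p + q) :=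
  DirectSum.toModule k _ _ fun γ' =>
    (DirectSum.toModule k _ _ fun γ => (Δ.cycleCupAux p q γ' γ).flip).flip

/-- The space `HH^n(A) ⊕ ⊕_γ H^n_γ(Δ)`, over the cycles `γ` of length at most `n` that are not
vertices. -/
abbrev Target (n : ℕ) : Type _ := HH k Δ.Alg n × Δ.PosCycleCoh n

open scoped Classical in
/-- The identification of `HH^n(A) ⊕ ⊕_γ H^n_γ(Δ)`, over the cycles that are not vertices, with
`⊕_γ H^n_γ(Δ)` over all the cycles. -/
def Target.toCycleCoh (n : ℕ) : Δ.Target n →ₗ[k] Δ.CycleCoh n :=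
  let _ := Fintype.ofFinite V
  LinearMap.coprod
    (∑ x : V, DirectSum.lof k (Cycle V n) (fun γ => Δ.KH γ.path n) ⟨x, .nil, Nat.zero_le n⟩ ∘ₗ
      Δ.toVertex x n)
    (DirectSum.toModule k _ _ fun γ =>
      DirectSum.lof k (Cycle V n) (fun γ => Δ.KH γ.path n) γ.toCycle)

open scoped Classical in
/-- The projection to the summands of the cycles that are not vertices. -/
def dropVertices (n : ℕ) : Δ.CycleCoh n →ₗ[k] Δ.PosCycleCoh n :=
  DirectSum.toModule k _ _ fun γ =>
    if h : 0 < γ.path.length then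
      DirectSum.lof k (PosCycle V n) (fun γ => Δ.KH γ.path n) ⟨γ, h⟩
    else 0

/-- The product of `HH^*(A) ⊕ ⊕_γ H^*_γ(Δ)`: the cup product of `HH^*(A)` on the first summand,
and the cup product along cycles in general, where the classes of `HH^*(A)` are regarded as sums of
classes along vertices. -/
def Target.cup {p q : ℕ} (u : Δ.Target p) (v : Δ.Target q) : Δ.Target (p + q) :=
  (HH.cup k Δ.Alg p q u.1 v.1,
    Δ.dropVertices (p + q)
      (Δ.cycleCup p q (Target.toCycleCoh Δ p u) (Target.toCycleCoh Δ q v)))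

/-- The unit of `HH^*(A) ⊕ ⊕_γ H^*_γ(Δ)`. -/
def Target.one : Δ.Target 0 := (HH.one k Δ.Alg, 0)

open scoped Classical in
/-- The map `HH^n(Λ_Δ) → HH^n(A) ⊕ ⊕_γ H^n_γ(Δ)`, over the cycles `γ` of length at most `n` that
are not vertices. -/
def toTarget (n : ℕ) : HH k Δ.Lam n →ₗ[k] Δ.Target n :=
  let _ := Fintype.ofFinite (PosCycle V n)
  (Δ.toAlg n).prod
    (∑ γ : PosCycle V n,
      DirectSum.lof k (PosCycle V n) (fun γ => Δ.KH γ.path n) γ ∘ₗ Δ.toCycle γ.path n)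

end Maps

end QSet

end QSets

end

end HochschildPaths

/-!
The algebra `Λ_Δ = A ⊕ M` has `M M = 0`, and everything follows from keeping track of the
`A`-components of cochains.

A cochain along a path `δ` with different source and target has values in `t(δ) Λ_Δ s(δ)`, which is
contained in `M`. Hence the product of any two cochains in `D` vanishes already as a cochain
(`cup_eq_zero_of_mem_nonCycleCochains`), and so do the products of the classes they represent.

The map to `HH^*(A)` is multiplicative on cochains, since `Λ_Δ → A` is a morphism of algebras. For a
cycle `γ` at `x`, absence of loops gives `x Λ_Δ x = A_x`, so only the `A_x`-components of the values
matter. A trajectory over `γ` cut in two consists of trajectories over paths `ω : x ⟶ z` and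
`ω' : z ⟶ x` with `ω' ω = γ` (`IsTrajectory.split`). If `z = x`, the two parts contribute the
product of the components along the cycles `ω'` and `ω`. If `z ≠ x`, they contribute nothing to the
product along cycles, whereas a general cocycle `f` can have a non zero `A_x`-component on
trajectories over `ω'`. This component can be removed by adding a coboundary to `f`: the last entry
of the trajectory is fixed by right multiplication with `1 - x`, and neither this entry nor `1 - x`
has an `A_x`-component, so that inserting `1 - x` as last variable is a contracting homotopy for the
`A_x`-components of the values
(`exists_sub_mem_coboundaries_fst_eq_zero`). With this choice of `f` the component along `γ` is
multiplicative on cochains (`component_cup_eq_component_cup_cyclePart`). The remaining lemmas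
describe the product of the target by cochains: its component along `γ` is represented by the
component along `γ` of the cup product of the sums of the components along cycles
(`represents_cycleCupAux`).
-/

open scoped DirectSum

namespace HochschildPaths

noncomputable section

/-! ### Classes represented by cochains -/

section Cohomology

variable {k : Type*} [Field k]
variable {X : ℕ → Type*} [∀ n, AddCommGroup (X n)] [∀ n, Module k (X n)]
variable (d : ∀ m n : ℕ, m + 1 = n → (X m →ₗ[k] X n))

theorem Cohomology.mk_surjective (n : ℕ) : Function.Surjective (Cohomology.mk d n) :=
  Submodule.mkQ_surjective _

theorem Cohomology.mk_eq_mk {n : ℕ} {f g : cocycles d n} :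
    Cohomology.mk d n f = Cohomology.mk d n g ↔ f.1 - g.1 ∈ coboundaries d n :=
  Submodule.Quotient.eq _

/-- The class `w` is represented by the cochain `c`, which is then a cocycle. -/
def Represents {n : ℕ} (c : X n) (w : Cohomology d n) : Prop :=
  ∃ hc : c ∈ cocycles d n, Cohomology.mk d n ⟨c, hc⟩ = w

variable {d}

theorem Represents.eq_of_sub_mem {n : ℕ} {c c' : X n} {w w' : Cohomology d n}
    (h : Represents d c w) (h' : Represents d c' w') (hc : c - c' ∈ coboundaries d n) : w = w' := by
  obtain ⟨_, rfl⟩ := h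
  obtain ⟨_, rfl⟩ := h'
  exact (Cohomology.mk_eq_mk d).2 hc

theorem represents_zero (n : ℕ) : Represents d (0 : X n) 0 :=
  ⟨Submodule.zero_mem _, map_zero (Cohomology.mk d n)⟩

theorem Represents.add {n : ℕ} {c c' : X n} {w w' : Cohomology d n} (h : Represents d c w)
    (h' : Represents d c' w') : Represents d (c + c') (w + w') := by
  obtain ⟨hc, rfl⟩ := h
  obtain ⟨hc', rfl⟩ := h'
  exact ⟨Submodule.add_mem _ hc hc', map_add (Cohomology.mk d n) ⟨c, hc⟩ ⟨c', hc'⟩⟩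

theorem Represents.sum {n : ℕ} {ι : Type*} (s : Finset ι) {c : ι → X n}
    {w : ι → Cohomology d n} (h : ∀ i, Represents d (c i) (w i)) :
    Represents d (∑ i ∈ s, c i) (∑ i ∈ s, w i) := by
  classical
  induction s using Finset.induction_on with
  | empty => exact represents_zero n
  | insert i s hi ih =>
    rw [Finset.sum_insert hi, Finset.sum_insert hi]
    exact (h i).add ih

end Cohomology

/-! ### Fixing the last variable of a Hochschild cochain -/

section LastVariable

variable {k : Type*} [Field k] {R : Type*} [Ring R] [Algebra k R]

/-- The cochain `(x₀, …, x_{m-1}) ↦ f(x₀, …, x_{m-1}, w)`. -/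
def evalLast {m : ℕ} (w : R) (f : HCochain k R (m + 1)) : HCochain k R m :=
  (LinearMap.applyₗ w).compMultilinearMap f.curryRight

theorem evalLast_apply {m : ℕ} (w : R) (f : HCochain k R (m + 1)) (z : Fin m → R) :
    evalLast w f z = f (Fin.snoc z w) := rfl

theorem snoc_apply {α : Type*} {m : ℕ} (z : Fin m → α) (w : α) (i : Fin (m + 1)) :
    (Fin.snoc z w : Fin (m + 1) → α) i = if h : (i : ℕ) < m then z ⟨i, h⟩ else w := by
  simp only [Fin.snoc]
  rfl

/-- Fixing the last variable commutes with the Hochschild coboundary up to the terms in which the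
last two variables interact with each other or with the value of the cochain. -/
theorem hd_snoc {m : ℕ} (w : R) (f : HCochain k R (m + 1)) (z : Fin (m + 1) → R) :
    hd (m + 1) (m + 1 + 1) rfl f (Fin.snoc z w) = hd m (m + 1) rfl (evalLast w f) z
      - (-1 : k) ^ (m + 1) • (evalLast w f (slice 0 m (by omega) z) * z (Fin.last m))
      + (-1 : k) ^ (m + 1) • f (Fin.snoc (slice 0 m (by omega) z) (z (Fin.last m) * w))
      + (-1 : k) ^ (m + 1 + 1) • (f z * w) := by
  rw [hd_apply, hd_apply, Fin.sum_univ_castSucc]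
  have hz : ∀ (a b : ℕ) (ha : a < m + 1) (hb : b < m + 1), a = b → z ⟨a, ha⟩ = z ⟨b, hb⟩ := by
    intro a b ha hb e; subst e; rfl
  have e1 : slice 1 (m + 1) (by omega) (Fin.snoc z w : Fin (m + 1 + 1) → R) =
      Fin.snoc (slice 1 m (by omega) z) w := by
    funext j
    simp only [slice, snoc_apply]
    split_ifs <;> first | rfl | omega
  have e2 : ∀ i : Fin m, contract rfl i.castSucc (Fin.snoc z w : Fin (m + 1 + 1) → R) =
      Fin.snoc (contract rfl i z) w := by
    intro i
    funext j
    have := i.2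
    simp only [contract, snoc_apply, Fin.lt_def, Fin.ext_iff, Fin.val_castSucc]
    split_ifs <;> first | rfl | omega
  have e3 : contract rfl (Fin.last m) (Fin.snoc z w : Fin (m + 1 + 1) → R) =
      Fin.snoc (slice 0 m (by omega) z) (z (Fin.last m) * w) := by
    funext j
    have := j.2
    simp only [contract, slice, snoc_apply, Fin.lt_def, Fin.ext_iff, Fin.val_last]
    split_ifs <;> first | omega | exact hz _ _ _ _ (by omega) |
      exact congrArg (· * w) (hz _ _ _ _ (by omega))
  have e4 : slice 0 (m + 1) (by omega) (Fin.snoc z w : Fin (m + 1 + 1) → R) = z := by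
    funext j
    have := j.2
    simp only [slice, snoc_apply]
    rw [dif_pos (by omega)]
    exact hz _ _ _ _ (by omega)
  have e5 : (Fin.snoc z w : Fin (m + 1 + 1) → R) ⟨0, by omega⟩ = z ⟨0, by omega⟩ := by
    rw [snoc_apply, dif_pos (by simp)]
  have e6 : (Fin.snoc z w : Fin (m + 1 + 1) → R) ⟨m + 1, by omega⟩ = w := by
    rw [snoc_apply, dif_neg (by simp)]
  rw [e1, e3, e4, e5, e6]
  simp only [e2, evalLast_apply, Fin.val_castSucc, Fin.val_last]
  have e7 : z ⟨m, by omega⟩ = z (Fin.last m) := rfl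
  rw [e7]
  abel

end LastVariable

section QSets

open Quiver

variable {k : Type*} [Field k] {V : Type*} [Quiver V]

instance (V : Type*) [Quiver V] [Finite V] [∀ x y : V, Subsingleton (x ⟶ y)] (n : ℕ) :
    Finite (Cycle V n) := by
  have := finite_paths V n
  refine Finite.of_injective (β := {ω : Σ x y : V, Path x y // ω.2.2.length ≤ n})
    (fun γ => ⟨⟨γ.vertex, γ.vertex, γ.path⟩, γ.length_le⟩) ?_
  rintro ⟨x, γ, h⟩ ⟨x', γ', h'⟩ he
  cases he
  rfl

instance (V : Type*) [Quiver V] [Finite V] [∀ x y : V, Subsingleton (x ⟶ y)] (n : ℕ) :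
    Fintype (Cycle V n) := Fintype.ofFinite _

namespace QSet

/-! ### Trajectories -/

theorem IsTrajectory.length_le (l : List (Cell V)) : ∀ {x y : V} {ω : Path x y},
    IsTrajectory ω l → ω.length ≤ l.length := by
  induction l with
  | nil =>
    intro x y ω h
    cases ω with
    | nil => simp
    | cons ω e => exact h.elim
  | cons c l ih =>
    intro x y ω h
    rcases c with z | a
    · rw [isTrajectory_cons_inl] at h
      exact (ih h.2).trans (by simp)
    · cases ω with
      | nil => exact h.elim
      | cons ω e => simpa using ih h.2

/-- A sequence determines the path over which it is a trajectory, once the target is known. The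
target is needed for the empty sequence, which is a trajectory over every vertex. -/
theorem IsTrajectory.unique (l : List (Cell V)) : ∀ {x x' y : V} {ω : Path x y} {ω' : Path x' y},
    IsTrajectory ω l → IsTrajectory ω' l → (⟨x, ω⟩ : Σ x, Path x y) = ⟨x', ω'⟩ := by
  induction l with
  | nil =>
    intro x x' y ω ω' h h'
    cases ω with
    | nil =>
      cases ω' with
      | nil => rfl
      | cons _ _ => exact h'.elim
    | cons _ _ => exact h.elim
  | cons c l ih =>
    intro x x' y ω ω' h h'
    rcases c with z | a
    · rw [isTrajectory_cons_inl] at h h'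
      exact ih h.2 h'.2
    · cases ω with
      | nil => exact h.elim
      | cons ω e =>
        cases ω' with
        | nil => exact h'.elim
        | cons ω' e' =>
          obtain ⟨rfl, h1⟩ := h
          obtain ⟨h2, h3⟩ := h'
          cases h2
          cases ih h1 h3
          rfl

/-- A trajectory that is cut in two is the concatenation of trajectories over two paths that
compose to the given one. -/
theorem IsTrajectory.split (l r : List (Cell V)) : ∀ {x y : V} {ω : Path x y},
    IsTrajectory ω (l ++ r) → ∃ (z : V) (ω' : Path z y) (ω'' : Path x z),
      ω = ω''.comp ω' ∧ IsTrajectory ω' l ∧ IsTrajectory ω'' r := by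
  induction l with
  | nil => exact fun {x y ω} h => ⟨y, .nil, ω, rfl, trivial, h⟩
  | cons c l ih =>
    intro x y ω h
    rcases c with z | a
    · rw [List.cons_append, isTrajectory_cons_inl] at h
      obtain ⟨w, ω', ω'', e, h1, h2⟩ := ih h.2
      exact ⟨w, ω', ω'', e, (isTrajectory_cons_inl _ _ _).2 ⟨h.1, h1⟩, h2⟩
    · cases ω with
      | nil => exact h.elim
      | cons ω e =>
        obtain ⟨w, ω', ω'', rfl, h1, h2⟩ := ih h.2
        exact ⟨w, ω'.cons e, ω'', rfl, ⟨h.1, h1⟩, h2⟩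

theorem IsTrajectory.append (l r : List (Cell V)) : ∀ {x y z : V} {ω' : Path z y} {ω'' : Path x z},
    IsTrajectory ω' l → IsTrajectory ω'' r → IsTrajectory (ω''.comp ω') (l ++ r) := by
  induction l with
  | nil =>
    intro x y z ω' ω'' h h'
    cases ω' with
    | nil => exact h'
    | cons _ _ => exact h.elim
  | cons c l ih =>
    intro x y z ω' ω'' h h'
    rcases c with w | a
    · rw [isTrajectory_cons_inl] at h
      exact (isTrajectory_cons_inl _ _ _).2 ⟨h.1, ih h.2 h'⟩
    · cases ω' with
      | nil => exact h.elim
      | cons ω e => exact ⟨h.1, ih h.2 h'⟩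

theorem ofFn_slice_append_slice {α : Type*} {p q n : ℕ} (h : p + q = n) (σ : Fin n → α) :
    List.ofFn σ = List.ofFn (slice 0 p (by omega) σ) ++ List.ofFn (slice p q (by omega) σ) := by
  subst h
  rw [List.ofFn_add]
  congr 2
  funext j
  simp only [slice]
  congr 1
  ext
  simp

theorem IsTrajectory.eq_inl {x : V} {l : List (Cell V)} (h : IsTrajectory (.nil : Path x x) l) :
    ∀ c ∈ l, c = .inl x := by
  induction l with
  | nil => simp
  | cons c l ih =>
    rcases c with z | a
    · rw [isTrajectory_cons_inl] at h
      obtain ⟨rfl, h⟩ := h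
      simpa using ih h
    · exact h.elim

/-- The last entry of a nonempty trajectory starts at the source of the path. -/
theorem IsTrajectory.last {l : List (Cell V)} {c : Cell V} : ∀ {x y : V} {ω : Path x y},
    IsTrajectory ω (l ++ [c]) → c = .inl x ∨ ∃ a : Total V, c = .inr a ∧ a.left = x := by
  intro x y ω h
  obtain ⟨z, ω', ω'', -, -, h⟩ := h.split
  rcases c with w | a
  · rw [isTrajectory_cons_inl] at h
    obtain ⟨rfl, h⟩ := h
    cases ω'' with
    | nil => exact Or.inl rfl
    | cons _ _ => exact h.elim
  · cases ω'' with
    | nil => exact h.elim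
    | cons ω e =>
      obtain ⟨rfl, h⟩ := h
      cases ω with
      | nil => exact Or.inr ⟨_, rfl, rfl⟩
      | cons _ _ => exact h.elim

variable (Δ : QSet k V)

/-! ### Components in `A_x` -/

theorem fst_e_self (x : V) : (Δ.e x).fst x = 1 := by
  classical
  exact Pi.single_eq_same (M := Δ.A) x 1

theorem fst_e_ne {x y : V} (h : x ≠ y) : (Δ.e y).fst x = 0 := by
  classical
  exact Pi.single_eq_of_ne (M := Δ.A) h 1

theorem fst_corner_self (x : V) (z : Δ.Lam) : (Δ.corner x x z).fst x = z.fst x := by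
  rw [corner_apply, TrivSqZeroExt.fst_mul, TrivSqZeroExt.fst_mul, Pi.mul_apply, Pi.mul_apply,
    fst_e_self, one_mul, mul_one]

theorem fst_corner_ne {x y : V} (h : x ≠ y) (z : Δ.Lam) : (Δ.corner y y z).fst x = 0 := by
  rw [corner_apply, TrivSqZeroExt.fst_mul, Pi.mul_apply, fst_e_ne Δ h, mul_zero]

theorem fst_of_mem_counterpart_cycle {x y : V} (h : x ≠ y) {γ : Path y y} {z : Δ.Lam}
    (hz : z ∈ Δ.counterpart γ) : z.fst x = 0 := by
  rw [← Δ.corner_of_mem hz, Δ.fst_corner_ne h]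

/-- In the absence of loops, `x Λ_Δ x = A_x`. -/
theorem corner_self_congr [∀ x : V, IsEmpty (x ⟶ x)] (x : V) {z w : Δ.Lam}
    (h : z.fst x = w.fst x) : Δ.corner x x z = Δ.corner x x w := by
  have h1 : ∀ u : Δ.Lam, Δ.corner x x (Δ.corner x x u) = Δ.corner x x u := fun u =>
    Δ.corner_of_mem (ω := (.nil : Path x x)) ⟨u, rfl⟩
  rw [← h1 z, ← h1 w, ← sub_eq_zero, ← map_sub]
  refine Δ.corner_eq_zero x (funext fun y => ?_)
  rw [TrivSqZeroExt.fst_sub, Pi.sub_apply]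
  by_cases hy : y = x
  · subst hy
    rw [fst_corner_self, fst_corner_self, h, sub_self]
    rfl
  · rw [fst_corner_ne Δ hy, fst_corner_ne Δ hy, sub_self]
    rfl

theorem component_eq_of_fst [∀ x : V, IsEmpty (x ⟶ x)] {x : V} (γ : Path x x) {n : ℕ}
    {f g : HCochain k Δ.Lam n}
    (h : ∀ (σ : Fin n → Cell V) (v : ∀ i, Δ.Space (σ i)), IsTrajectory γ (List.ofFn σ) →
      (f (Δ.word σ v)).fst x = (g (Δ.word σ v)).fst x) :
    Δ.component γ n f = Δ.component γ n g := by
  funext ⟨σ, hσ⟩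
  refine MultilinearMap.ext fun v => Subtype.ext ?_
  rw [component_apply, component_apply]
  exact Δ.corner_self_congr x (h σ v hσ)

/-! ### Vanishing on trajectories that start at another vertex -/

/-- Up to a coboundary, a cocycle has no `A_x`-component on the trajectories over paths that end at
`x` but start at another vertex. On such a trajectory the last entry `z` satisfies
`z (1 - x) = z`, and neither `z` nor `1 - x` has an `A_x`-component; hence inserting `1 - x` as last
variable is a contracting homotopy for the `A_x`-components. -/
theorem exists_sub_mem_coboundaries_fst_eq_zero (x : V) {n : ℕ} (f : HCochain k Δ.Lam n)
    (hf : f ∈ cocycles (X := HCochain k Δ.Lam) hd n) :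
    ∃ f' : HCochain k Δ.Lam n, f' - f ∈ coboundaries (X := HCochain k Δ.Lam) hd n ∧
      ∀ (σ : Fin n → Cell V) (v : ∀ i, Δ.Space (σ i)) (y : V) (ω : Path y x), y ≠ x →
        IsTrajectory ω (List.ofFn σ) → (f' (Δ.word σ v)).fst x = 0 := by
  cases n with
  | zero =>
    refine ⟨f, by rw [sub_self]; exact Submodule.zero_mem _, fun σ v y ω hy h => ?_⟩
    rw [List.ofFn_zero] at h
    cases ω with
    | nil => exact absurd rfl hy
    | cons _ _ => exact h.elim
  | succ m =>
    obtain ⟨w, hw⟩ : ∃ w : Δ.Lam, w = 1 - Δ.e x := ⟨_, rfl⟩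
    -- `hd_snoc` at `df = 0` makes `d (evalLast w f)` equal to `(-1)^m f` in `A_x`-components
    refine ⟨f + (-1 : k) ^ (m + 1) • hd m (m + 1) rfl (evalLast w f), ?_, ?_⟩
    · rw [add_sub_cancel_left]
      exact Submodule.smul_mem _ _ (mem_coboundaries (X := HCochain k Δ.Lam) hd rfl _)
    · intro σ v y ω hy h
      obtain ⟨z, hz⟩ : ∃ z, z = Δ.word σ v := ⟨_, rfl⟩
      rw [← hz]
      rw [ofFn_slice_append (rfl : m + 1 = m + 1)] at h
      have hlast : (z (Fin.last m)).fst x = 0 ∧ z (Fin.last m) * Δ.e x = 0 := by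
        have h1 : z (Fin.last m) = Δ.incl (σ ⟨m, by omega⟩) (v ⟨m, by omega⟩) := by
          rw [hz]
          rfl
        rw [h1]
        generalize v ⟨m, by omega⟩ = u
        revert u
        rcases h.last with h2 | ⟨a, h2, h3⟩
        · rw [h2]
          intro u
          classical
          exact ⟨Pi.single_eq_of_ne (M := Δ.A) hy.symm u, Δ.ofA_mul_ofA_ne hy u 1⟩
        · rw [h2]
          intro u
          exact ⟨rfl, Δ.ofM_mul_ofA_ne (by rintro rfl; exact hy h3.symm) 1 u⟩
      have hwx : w.fst x = 0 := by
        rw [hw, TrivSqZeroExt.fst_sub, Pi.sub_apply, fst_e_self, TrivSqZeroExt.fst_one,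
          Pi.one_apply, sub_self]
      have h0 := hd_snoc (k := k) w f z
      have hmul : z (Fin.last m) * w = z (Fin.last m) := by
        rw [hw, mul_sub, mul_one, hlast.2, sub_zero]
      have hsnoc : (Fin.snoc (slice 0 m (by omega) z) (z (Fin.last m)) : Fin (m + 1) → Δ.Lam) =
          z := by
        have : slice 0 m (by omega) z = Fin.init z :=
          funext fun j => congrArg z (Fin.ext (Nat.zero_add _))
        rw [this, Fin.snoc_init_self]
      rw [LinearMap.mem_ker.1 hf, hmul, hsnoc] at h0
      have h4 := congrArg (fun u : Δ.Lam => u.fst x) h0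
      simp only [TrivSqZeroExt.fst_add, TrivSqZeroExt.fst_sub, TrivSqZeroExt.fst_smul,
        TrivSqZeroExt.fst_mul, Pi.add_apply, Pi.sub_apply, Pi.smul_apply, Pi.mul_apply, hwx,
        hlast.1, mul_zero, smul_zero, sub_zero, add_zero] at h4
      have h5 : (0 : Δ.A x) = (hd m (m + 1) rfl (evalLast w f) z).fst x +
          (-1 : k) ^ (m + 1) • (f z).fst x := h4
      rw [add_apply, _root_.smul_apply, TrivSqZeroExt.fst_add, TrivSqZeroExt.fst_smul, Pi.add_apply,
        Pi.smul_apply, eq_neg_of_add_eq_zero_left h5.symm, smul_neg, smul_smul, ← mul_pow]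
      simp

/-! ### Cup products of cochains of `Λ_Δ` -/

/-- On a word, the cup product is the product of the values on its two parts. The parts `v'` and
`v''` are not spelled out, so that their entries have the types required by `word`. -/
theorem exists_cup_word {p q n : ℕ} (h : p + q = n) (σ : Fin n → Cell V)
    (v : ∀ i, Δ.Space (σ i)) :
    ∃ (v' : ∀ i, Δ.Space (slice 0 p (by omega) σ i))
      (v'' : ∀ i, Δ.Space (slice p q (by omega) σ i)),
      ∀ (f : HCochain k Δ.Lam p) (g : HCochain k Δ.Lam q),
        cup p q n h f g (Δ.word σ v) = f (Δ.word _ v') * g (Δ.word _ v'') :=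
  ⟨fun _ => v _, fun _ => v _, fun _ _ => rfl⟩

theorem restrictAlg_cup {p q n : ℕ} (h : p + q = n) (f : HCochain k Δ.Lam p)
    (g : HCochain k Δ.Lam q) :
    Δ.restrictAlg n (cup p q n h f g) = cup p q n h (Δ.restrictAlg p f) (Δ.restrictAlg q g) :=
  MultilinearMap.ext fun _ => TrivSqZeroExt.fst_mul _ _

theorem toAlg_cup (p q : ℕ) (u : HH k Δ.Lam p) (v : HH k Δ.Lam q) :
    Δ.toAlg (p + q) (HH.cup k Δ.Lam p q u v) =
      HH.cup k Δ.Alg p q (Δ.toAlg p u) (Δ.toAlg q v) := by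
  obtain ⟨f, rfl⟩ := Cohomology.mk_surjective _ _ u
  obtain ⟨g, rfl⟩ := Cohomology.mk_surjective _ _ v
  exact congrArg (Cohomology.mk (X := HCochain k Δ.Alg) hd (p + q))
    (Subtype.ext (Δ.restrictAlg_cup rfl f.1 g.1))

section Maps

variable [Finite V] [∀ x y : V, Subsingleton (x ⟶ y)]

theorem fst_of_mem_nonCycleCochains {n : ℕ} {f : HCochain k Δ.Lam n}
    (hf : f ∈ Δ.nonCycleCochains n) (z : Fin n → Δ.Lam) : (f z).fst = 0 := by
  refine Submodule.iSup_induction _ (motive := fun f : HCochain k Δ.Lam n => (f z).fst = 0) hf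
    ?_ rfl ?_
  · rintro δ _ ⟨g, rfl⟩
    exact Δ.fst_of_mem_counterpart δ.ne (Δ.extend_mem δ.path g z)
  · intro f g hf hg
    rw [add_apply, TrivSqZeroExt.fst_add, hf, hg, add_zero]

/-- The values of cochains along paths that are not cycles lie in the square zero ideal `M`. -/
theorem cup_eq_zero_of_mem_nonCycleCochains {p q n : ℕ} (h : p + q = n) {f : HCochain k Δ.Lam p}
    {g : HCochain k Δ.Lam q} (hf : f ∈ Δ.nonCycleCochains p) (hg : g ∈ Δ.nonCycleCochains q) :
    cup p q n h f g = 0 :=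
  MultilinearMap.ext fun _ => Δ.mul_eq_zero_of_fst (Δ.fst_of_mem_nonCycleCochains hf _)
    (Δ.fst_of_mem_nonCycleCochains hg _)

theorem exists_mk_eq_fromNonCycles {n : ℕ} (u : ⨁ δ : NonCycle V n, Δ.KH δ.path n) :
    ∃ f : cocycles (X := HCochain k Δ.Lam) hd n, f.1 ∈ Δ.nonCycleCochains n ∧
      Cohomology.mk (X := HCochain k Δ.Lam) hd n f = Δ.fromNonCycles n u := by
  classical
  induction u using DirectSum.induction_on with
  | zero => exact ⟨0, Submodule.zero_mem _, by rw [map_zero, map_zero]⟩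
  | of δ u =>
    obtain ⟨f, rfl⟩ := Cohomology.mk_surjective _ _ u
    refine ⟨⟨Δ.extend δ.path n f.1, ?_⟩, Submodule.mem_iSup_of_mem δ ⟨f.1, rfl⟩, ?_⟩
    · rw [LinearMap.mem_ker, ← Δ.extend_kd δ.ne, LinearMap.mem_ker.1 f.2, map_zero]
    · refine Eq.trans ?_ (DirectSum.toModule_lof k δ _).symm
      rfl
  | add u v hu hv =>
    obtain ⟨f, hf, hf'⟩ := hu
    obtain ⟨g, hg, hg'⟩ := hv
    exact ⟨f + g, Submodule.add_mem _ hf hg, by rw [map_add, map_add, hf', hg']⟩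

theorem cup_fromNonCycles (p q : ℕ) (u : ⨁ δ : NonCycle V p, Δ.KH δ.path p)
    (v : ⨁ δ : NonCycle V q, Δ.KH δ.path q) :
    HH.cup k Δ.Lam p q (Δ.fromNonCycles p u) (Δ.fromNonCycles q v) = 0 := by
  obtain ⟨f, hf, hf'⟩ := Δ.exists_mk_eq_fromNonCycles u
  obtain ⟨g, hg, hg'⟩ := Δ.exists_mk_eq_fromNonCycles v
  rw [← hf', ← hg']
  refine (Submodule.Quotient.mk_eq_zero _).2 ?_
  change cup p q (p + q) rfl f.1 g.1 ∈ coboundaries (X := HCochain k Δ.Lam) hd (p + q)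
  rw [Δ.cup_eq_zero_of_mem_nonCycleCochains rfl hf hg]
  exact Submodule.zero_mem _

theorem dropVertices_apply (n : ℕ) (w : Δ.CycleCoh n) (γ : PosCycle V n) :
    Δ.dropVertices n w γ = w γ.toCycle := by
  classical
  induction w using DirectSum.induction_on with
  | zero => rw [map_zero]; rfl
  | of β a =>
    rw [dropVertices, ← DirectSum.lof_eq_of k, DirectSum.toModule_lof]
    split_ifs with h
    · by_cases hβ : γ = ⟨β, h⟩
      · subst hβ
        rw [DirectSum.lof_apply, DirectSum.lof_apply]
      · rw [DirectSum.lof_eq_of, DirectSum.lof_eq_of, DirectSum.of_eq_of_ne _ _ _ hβ,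
          DirectSum.of_eq_of_ne]
        rintro rfl
        exact hβ rfl
    · rw [DirectSum.lof_eq_of, DirectSum.of_eq_of_ne]
      · rfl
      · rintro rfl
        exact h γ.length_pos
  | add u v hu hv => rw [map_add, DirectSum.add_apply, DirectSum.add_apply, hu, hv]

/-! ### The component of a cochain along the cycles -/

/-- The sum of the components of a cochain along the cycles. -/
def cyclePart (n : ℕ) : HCochain k Δ.Lam n →ₗ[k] HCochain k Δ.Lam n :=
  ∑ γ : Cycle V n, Δ.extend γ.path n ∘ₗ Δ.component γ.path n

theorem cyclePart_eq_sum (n : ℕ) (f : HCochain k Δ.Lam n) :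
    Δ.cyclePart n f = ∑ γ : Cycle V n, Δ.extend γ.path n (Δ.component γ.path n f) := by
  rw [cyclePart, LinearMap.sum_apply]
  rfl

/-- Cycles of length greater than `m` have no trajectories of duration `m`. -/
theorem cyclePart_eq_sum_of_le {m n : ℕ} (h : m ≤ n) (f : HCochain k Δ.Lam m) :
    Δ.cyclePart m f = ∑ γ : Cycle V n, Δ.extend γ.path m (Δ.component γ.path m f) := by
  rw [cyclePart_eq_sum]
  refine Fintype.sum_of_injective
    (fun γ : Cycle V m => (⟨γ.vertex, γ.path, γ.length_le.trans h⟩ : Cycle V n)) ?_ _ _ ?_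
    fun _ => rfl
  · rintro ⟨x, γ, hl⟩ ⟨x', γ', hl'⟩ he
    cases he
    rfl
  · intro γ hγ
    have h0 : Δ.component γ.path m f = 0 := funext fun τ =>
      absurd ⟨⟨γ.vertex, γ.path, by simpa using τ.2.length_le⟩, rfl⟩ hγ
    rw [h0, map_zero]

theorem fst_cyclePart (n : ℕ) (f : HCochain k Δ.Lam n) (z : Fin n → Δ.Lam) (x : V) :
    (Δ.cyclePart n f z).fst x =
      ∑ γ : Cycle V n, (Δ.extend γ.path n (Δ.component γ.path n f) z).fst x := by
  rw [cyclePart_eq_sum, sum_apply]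
  change LinearMap.proj (R := k) (φ := Δ.A) x (Δ.fstLin _) = _
  rw [map_sum, map_sum]
  rfl

theorem fst_cyclePart_of_cycle {n : ℕ} (f : HCochain k Δ.Lam n) {x : V} (γ : Path x x)
    (σ : Fin n → Cell V) (v : ∀ i, Δ.Space (σ i)) (hσ : IsTrajectory γ (List.ofFn σ)) :
    (Δ.cyclePart n f (Δ.word σ v)).fst x = (f (Δ.word σ v)).fst x := by
  rw [fst_cyclePart, Finset.sum_eq_single (⟨x, γ, by simpa using hσ.length_le⟩ : Cycle V n)]
  · rw [Δ.extend_word γ _ σ hσ, component_apply, fst_corner_self]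
  · rintro ⟨y, γ', hl⟩ - hne
    by_cases hy : x = y
    · subst hy
      rw [Δ.extend_word_of_not]
      · rfl
      · intro h
        have := IsTrajectory.unique _ hσ h
        rw [Sigma.mk.injEq] at this
        cases eq_of_heq this.2
        exact hne rfl
    · exact Δ.fst_of_mem_counterpart_cycle hy (Δ.extend_mem γ' _ _)
  · intro h
    exact absurd (Finset.mem_univ _) h

theorem fst_cyclePart_of_ne {n : ℕ} (f : HCochain k Δ.Lam n) {x z : V} (hz : z ≠ x)
    (ω : Path z x) (σ : Fin n → Cell V) (v : ∀ i, Δ.Space (σ i))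
    (hσ : IsTrajectory ω (List.ofFn σ)) :
    (Δ.cyclePart n f (Δ.word σ v)).fst x = 0 := by
  rw [fst_cyclePart]
  refine Finset.sum_eq_zero ?_
  rintro ⟨y, γ', hl⟩ -
  by_cases hy : x = y
  · subst hy
    rw [Δ.extend_word_of_not]
    · rfl
    · intro h
      have := IsTrajectory.unique _ hσ h
      rw [Sigma.mk.injEq] at this
      exact hz this.1
  · exact Δ.fst_of_mem_counterpart_cycle hy (Δ.extend_mem γ' _ _)

variable [∀ x : V, IsEmpty (x ⟶ x)]

/-- Cut a trajectory over a cycle at `x` into two trajectories. If both run over cycles, the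
components along these cycles account for the value of the cup product. Otherwise the first one runs
over a path to `x` from another vertex, and both sides vanish. -/
theorem component_cup_eq_component_cup_cyclePart {x : V} (γ : Path x x) {p q n : ℕ} (h : p + q = n)
    (f : HCochain k Δ.Lam p) (g : HCochain k Δ.Lam q)
    (hf : ∀ (σ : Fin p → Cell V) (v : ∀ i, Δ.Space (σ i)) (y : V) (ω : Path y x), y ≠ x →
        IsTrajectory ω (List.ofFn σ) → (f (Δ.word σ v)).fst x = 0) :
    Δ.component γ n (cup p q n h f g) =
      Δ.component γ n (cup p q n h (Δ.cyclePart p f) (Δ.cyclePart q g)) := by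
  refine Δ.component_eq_of_fst γ fun σ v hσ => ?_
  rw [ofFn_slice_append_slice h] at hσ
  obtain ⟨z, ω', ω, -, h1, h2⟩ := hσ.split
  obtain ⟨v', v'', hv⟩ := Δ.exists_cup_word h σ v
  rw [hv, hv, TrivSqZeroExt.fst_mul, TrivSqZeroExt.fst_mul, Pi.mul_apply, Pi.mul_apply]
  by_cases hz : z = x
  · subst hz
    rw [Δ.fst_cyclePart_of_cycle f ω' _ _ h1, Δ.fst_cyclePart_of_cycle g ω _ _ h2]
  · rw [hf _ _ z ω' hz h1, Δ.fst_cyclePart_of_ne f hz ω' _ _ h1, zero_mul, zero_mul]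

theorem component_cup_extend_of_ne {x : V} (γ : Path x x) {p q n : ℕ} (h : p + q = n)
    {y y' : V} (hne : y' ≠ y) (γ' : Path y' y') (γ'' : Path y y) (a : Δ.KCochain γ' p)
    (b : Δ.KCochain γ'' q) :
    Δ.component γ n (cup p q n h (Δ.extend γ' p a) (Δ.extend γ'' q b)) = 0 := by
  rw [← map_zero (Δ.component γ n)]
  refine Δ.component_eq_of_fst γ fun σ v hσ => ?_
  change _ = (0 : Δ.A x)
  rw [cup_apply, TrivSqZeroExt.fst_mul, Pi.mul_apply]
  by_cases hy : x = y
  · rw [Δ.fst_of_mem_counterpart_cycle (fun e => hne (e.symm.trans hy)) (Δ.extend_mem γ' _ _),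
      zero_mul]
  · rw [Δ.fst_of_mem_counterpart_cycle hy (Δ.extend_mem γ'' _ _), mul_zero]

/-- A trajectory over `γ` is not the concatenation of trajectories over `γ'` and `γ''`, unless `γ`
is the concatenation of these cycles. -/
theorem component_cup_extend_of_comp_ne {x y : V} (γ : Path x x) {p q n : ℕ} (h : p + q = n)
    (γ' γ'' : Path y y) (hne : (⟨y, γ''.comp γ'⟩ : Σ y : V, Path y y) ≠ ⟨x, γ⟩)
    (a : Δ.KCochain γ' p) (b : Δ.KCochain γ'' q) :
    Δ.component γ n (cup p q n h (Δ.extend γ' p a) (Δ.extend γ'' q b)) = 0 := by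
  rw [← map_zero (Δ.component γ n)]
  refine Δ.component_eq_of_fst γ fun σ v hσ => ?_
  change _ = (0 : Δ.A x)
  obtain ⟨v', v'', hv⟩ := Δ.exists_cup_word h σ v
  rw [hv, TrivSqZeroExt.fst_mul, Pi.mul_apply]
  by_cases hy : x = y
  · subst hy
    by_cases h1 : IsTrajectory γ' (List.ofFn (slice 0 p (by omega) σ))
    · by_cases h2 : IsTrajectory γ'' (List.ofFn (slice p q (by omega) σ))
      · have h3 := h1.append _ _ h2
        rw [← ofFn_slice_append_slice h] at h3
        have h4 := IsTrajectory.unique _ h3 hσ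
        rw [Sigma.mk.injEq] at h4
        exact absurd (by rw [eq_of_heq h4.2]) hne
      · rw [Δ.extend_word_of_not γ'' b _ h2]
        exact mul_zero _
    · rw [Δ.extend_word_of_not γ' a _ h1]
      exact zero_mul _
  · rw [Δ.fst_of_mem_counterpart_cycle hy (Δ.extend_mem γ' _ _), zero_mul]

/-- Up to values in `M`, the passage to the components along cycles commutes with the coboundary. -/
theorem fst_hd_cyclePart {m n : ℕ} (h : m + 1 = n) (f : HCochain k Δ.Lam m) (z : Fin n → Δ.Lam) :
    (hd m n h (Δ.cyclePart m f) z).fst = (Δ.cyclePart n (hd m n h f) z).fst := by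
  rw [Δ.cyclePart_eq_sum_of_le (show m ≤ n by omega), cyclePart_eq_sum, map_sum, sum_apply,
    sum_apply]
  refine (map_sum Δ.fstLin _ _).trans (Eq.trans ?_ (map_sum Δ.fstLin _ _).symm)
  refine Finset.sum_congr rfl fun γ _ => ?_
  rw [component_hd]
  exact Δ.fst_hd_extend γ.path h _ z

/-- Along a cycle `γ` at `x`, the product of two cocycles and the product of their components along
cycles differ by a coboundary: this holds on the nose if the first factor has no `A_x`-component on
trajectories that come from another vertex, and it holds if the first factor is a coboundary. -/
theorem component_cup_sub_mem_coboundaries {x : V} (γ : Path x x) {p q n : ℕ} (h : p + q = n)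
    (f : HCochain k Δ.Lam p) (g : HCochain k Δ.Lam q)
    (hf : f ∈ cocycles (X := HCochain k Δ.Lam) hd p)
    (hg : g ∈ cocycles (X := HCochain k Δ.Lam) hd q) :
    Δ.component γ n (cup p q n h f g) -
        Δ.component γ n (cup p q n h (Δ.cyclePart p f) (Δ.cyclePart q g)) ∈
      coboundaries (X := Δ.KCochain γ) (Δ.kd γ) n := by
  have hg0 := LinearMap.mem_ker.1 hg
  -- the case of a coboundary
  have hb : ∀ c ∈ coboundaries (X := HCochain k Δ.Lam) hd p,
      Δ.component γ n (cup p q n h c g) -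
          Δ.component γ n (cup p q n h (Δ.cyclePart p c) (Δ.cyclePart q g)) ∈
        coboundaries (X := Δ.KCochain γ) (Δ.kd γ) n := by
    intro c hc
    refine coboundaries_induction (X := HCochain k Δ.Lam) hd
      (P := fun c => Δ.component γ n (cup p q n h c g) -
          Δ.component γ n (cup p q n h (Δ.cyclePart p c) (Δ.cyclePart q g)) ∈
        coboundaries (X := Δ.KCochain γ) (Δ.kd γ) n) ?_ ?_ hc
    · simp
    · intro m hm b
      cases hm
      have hn : m + q + 1 = n := by omega
      subst hn
      have e1 : Δ.component γ (m + q + 1) (cup (m + 1) q (m + q + 1) h (hd m (m + 1) rfl b) g) =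
          Δ.kd γ (m + q) (m + q + 1) rfl (Δ.component γ (m + q) (cup m q (m + q) rfl b g)) := by
        rw [← component_hd, hd_cup, hg0, map_zero, smul_zero, add_zero]
      have e2 : Δ.component γ (m + q + 1) (cup (m + 1) q (m + q + 1) h
            (Δ.cyclePart (m + 1) (hd m (m + 1) rfl b)) (Δ.cyclePart q g)) =
          Δ.kd γ (m + q) (m + q + 1) rfl
            (Δ.component γ (m + q) (cup m q (m + q) rfl (Δ.cyclePart m b) (Δ.cyclePart q g))) := by
        rw [← component_hd, hd_cup]
        refine Δ.component_congr γ fun z => ?_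
        rw [add_apply, _root_.smul_apply, TrivSqZeroExt.fst_add, TrivSqZeroExt.fst_smul, cup_apply,
          cup_apply, cup_apply, TrivSqZeroExt.fst_mul, TrivSqZeroExt.fst_mul,
          TrivSqZeroExt.fst_mul, fst_hd_cyclePart, fst_hd_cyclePart, hg0, map_zero]
        change _ = _ + (-1 : k) ^ m • (_ * (0 : Δ.Alg))
        rw [mul_zero, smul_zero, add_zero]
      rw [e1, e2, ← map_sub]
      exact mem_coboundaries (X := Δ.KCochain γ) (Δ.kd γ) rfl _
  obtain ⟨f', hf', hx⟩ := Δ.exists_sub_mem_coboundaries_fst_eq_zero x f hf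
  have h1 := hb _ hf'
  simp only [map_sub, LinearMap.sub_apply] at h1
  rw [Δ.component_cup_eq_component_cup_cyclePart γ h f' g hx, sub_sub_sub_cancel_left] at h1
  rw [← neg_sub]
  exact Submodule.neg_mem _ h1

/-! ### The product of the target in terms of its components -/

/-- The component along `γ` of the product of two classes along cycles `γ'` and `γ''` is represented
by the component along `γ` of the cup product of cochains. Both vanish unless `γ` is the
concatenation of `γ'` and `γ''`. -/
theorem represents_cycleCupAux {p q : ℕ} (γ' : Cycle V p) (γ'' : Cycle V q) (γ : Cycle V (p + q))
    (a : cocycles (X := Δ.KCochain γ'.path) (Δ.kd γ'.path) p)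
    (b : cocycles (X := Δ.KCochain γ''.path) (Δ.kd γ''.path) q) :
    Represents (X := Δ.KCochain γ.path) (Δ.kd γ.path)
      (Δ.component γ.path (p + q)
        (cup p q (p + q) rfl (Δ.extend γ'.path p a.1) (Δ.extend γ''.path q b.1)))
      (Δ.cycleCupAux p q γ' γ'' (Cohomology.mk (X := Δ.KCochain γ'.path) (Δ.kd γ'.path) p a)
        (Cohomology.mk (X := Δ.KCochain γ''.path) (Δ.kd γ''.path) q b) γ) := by
  classical
  obtain ⟨x, γ', hl'⟩ := γ'
  obtain ⟨y, γ'', hl''⟩ := γ''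
  obtain ⟨z, γ, hl⟩ := γ
  by_cases hxy : x = y
  · subst hxy
    obtain ⟨w, hw⟩ : ∃ w, w = KH.cup Δ γ' γ'' p q
      (Cohomology.mk (X := Δ.KCochain γ') (Δ.kd γ') p a)
      (Cohomology.mk (X := Δ.KCochain γ'') (Δ.kd γ'') q b) := ⟨_, rfl⟩
    have h1 : Δ.cycleCupAux p q ⟨x, γ', hl'⟩ ⟨x, γ'', hl''⟩
        (Cohomology.mk (X := Δ.KCochain γ') (Δ.kd γ') p a)
        (Cohomology.mk (X := Δ.KCochain γ'') (Δ.kd γ'') q b) =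
        DirectSum.lof k (Cycle V (p + q)) (fun β => Δ.KH β.path (p + q))
          ⟨x, γ''.comp γ', by rw [Path.length_comp]; omega⟩ w := by
      rw [hw]
      simp only [cycleCupAux, dif_pos]
      rfl
    rw [h1]
    by_cases hc : (⟨x, γ''.comp γ', by rw [Path.length_comp]; omega⟩ : Cycle V (p + q)) =
        ⟨z, γ, hl⟩
    · cases hc
      rw [DirectSum.lof_apply, hw]
      exact ⟨_, rfl⟩
    · rw [DirectSum.lof_eq_of, DirectSum.of_eq_of_ne _ _ _ (Ne.symm hc),
        Δ.component_cup_extend_of_comp_ne]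
      · exact represents_zero _
      · intro h2
        cases h2
        exact hc rfl
  · have h1 : Δ.cycleCupAux p q ⟨x, γ', hl'⟩ ⟨y, γ'', hl''⟩ = 0 := by
      simp only [cycleCupAux, dif_neg hxy]
    rw [h1, Δ.component_cup_extend_of_ne _ _ hxy]
    exact represents_zero _

theorem cycleCup_apply (p q : ℕ) (u : Δ.CycleCoh p) (v : Δ.CycleCoh q) (γ : Cycle V (p + q)) :
    Δ.cycleCup p q u v γ =
      ∑ γ' : Cycle V p, ∑ γ'' : Cycle V q, Δ.cycleCupAux p q γ' γ'' (u γ') (v γ'') γ := by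
  classical
  have h1 : ∀ (γ' : Cycle V p) (γ'' : Cycle V q) (a : Δ.KH γ'.path p) (b : Δ.KH γ''.path q),
      Δ.cycleCup p q (DirectSum.of (fun γ : Cycle V p => Δ.KH γ.path p) γ' a)
        (DirectSum.of (fun γ : Cycle V q => Δ.KH γ.path q) γ'' b) =
          Δ.cycleCupAux p q γ' γ'' a b := by
    intro γ' γ'' a b
    rw [cycleCup, ← DirectSum.lof_eq_of k, ← DirectSum.lof_eq_of k, DirectSum.toModule_lof,
      LinearMap.flip_apply, DirectSum.toModule_lof, LinearMap.flip_apply]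
  conv_lhs => rw [← DirectSum.sum_univ_of u, ← DirectSum.sum_univ_of v]
  simp only [map_sum, LinearMap.sum_apply, h1]
  rw [Finset.sum_comm]
  simp only [DirectSum.sum_apply]

/-- A trajectory over a vertex has no arrows, so the component along it only depends on the
restriction to `A`. -/
theorem toVertex_toAlg (x : V) (n : ℕ) (u : HH k Δ.Lam n) :
    Δ.toVertex x n (Δ.toAlg n u) = Δ.toCycle (.nil : Path x x) n u := by
  obtain ⟨f, rfl⟩ := Cohomology.mk_surjective _ _ u
  refine congrArg (Cohomology.mk (X := Δ.KCochain (.nil : Path x x)) (Δ.kd .nil) n)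
    (Subtype.ext ?_)
  refine Δ.component_eq_of_fst _ fun σ v hσ => ?_
  have h : (fun i => Δ.inlLin (Δ.fstLin (Δ.word σ v i))) = Δ.word σ v := by
    funext i
    have hi : σ i = .inl x := hσ.eq_inl _ (by simp)
    change Δ.inlLin (Δ.fstLin (Δ.incl (σ i) (v i))) = Δ.incl (σ i) (v i)
    generalize v i = u
    revert u
    rw [hi]
    exact fun u => rfl
  change (f.1 fun i => Δ.inlLin (Δ.fstLin (Δ.word σ v i))).fst x = _
  rw [h]
  rfl

theorem toTarget_snd_apply (n : ℕ) (u : HH k Δ.Lam n) (γ : PosCycle V n) :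
    (Δ.toTarget n u).2 γ = Δ.toCycle γ.path n u := by
  classical
  let _ := Fintype.ofFinite (PosCycle V n)
  have h1 : (Δ.toTarget n u).2 = ∑ β : PosCycle V n,
      DirectSum.lof k (PosCycle V n) (fun γ => Δ.KH γ.path n) β (Δ.toCycle β.path n u) := by
    change (∑ γ : PosCycle V n,
      DirectSum.lof k (PosCycle V n) (fun γ => Δ.KH γ.path n) γ ∘ₗ Δ.toCycle γ.path n) u = _
    rw [LinearMap.sum_apply]
    rfl
  rw [h1, DirectSum.sum_apply, Finset.sum_eq_single γ]
  · exact DirectSum.lof_apply _ _ _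
  · intro β _ hβ
    exact DirectSum.of_eq_of_ne _ _ _ hβ.symm
  · intro h
    exact absurd (Finset.mem_univ _) h

/-- The composite `HH^n(Λ_Δ) → ⊕_γ H^n_γ(Δ)`, over all cycles, takes components along the cycles. -/
theorem toCycleCoh_toTarget_apply (n : ℕ) (u : HH k Δ.Lam n) (γ : Cycle V n) :
    Target.toCycleCoh Δ n (Δ.toTarget n u) γ = Δ.toCycle γ.path n u := by
  classical
  let _ := Fintype.ofFinite V
  have h0 : Target.toCycleCoh Δ n (Δ.toTarget n u) =
      ∑ x : V, DirectSum.lof k (Cycle V n) (fun γ => Δ.KH γ.path n) ⟨x, .nil, Nat.zero_le n⟩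
        (Δ.toCycle (.nil : Path x x) n u) +
      DirectSum.toModule k _ _ (fun γ : PosCycle V n =>
        DirectSum.lof k (Cycle V n) (fun γ => Δ.KH γ.path n) γ.toCycle) (Δ.toTarget n u).2 := by
    simp only [← toVertex_toAlg]
    rw [Target.toCycleCoh, LinearMap.coprod_apply, LinearMap.sum_apply]
    congr
  have hpos : ∀ w : Δ.PosCycleCoh n, DirectSum.toModule k _ _ (fun γ : PosCycle V n =>
        DirectSum.lof k (Cycle V n) (fun γ => Δ.KH γ.path n) γ.toCycle) w γ =
      if h : 0 < γ.path.length then w ⟨γ, h⟩ else 0 := by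
    intro w
    induction w using DirectSum.induction_on with
    | zero => rw [map_zero]; split_ifs <;> rfl
    | of β a =>
      rw [← DirectSum.lof_eq_of k, DirectSum.toModule_lof]
      by_cases hβ : γ = β.toCycle
      · subst hβ
        rw [dif_pos β.length_pos, DirectSum.lof_apply, DirectSum.lof_apply]
      · rw [DirectSum.lof_eq_of, DirectSum.of_eq_of_ne _ _ _ hβ]
        split_ifs with h
        · rw [DirectSum.lof_eq_of, DirectSum.of_eq_of_ne]
          rintro rfl
          exact hβ rfl
        · rfl
    | add v w hv hw =>
      rw [map_add, DirectSum.add_apply, hv, hw]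
      split_ifs
      · rfl
      · exact add_zero 0
  rw [h0, DirectSum.add_apply, hpos, DirectSum.sum_apply]
  obtain ⟨y, ω, hl⟩ := γ
  cases ω with
  | nil =>
    rw [dif_neg (by simp), add_zero, Finset.sum_eq_single y]
    · exact DirectSum.lof_apply _ _ _
    · intro x _ hx
      refine DirectSum.of_eq_of_ne _ _ _ ?_
      rintro ⟨⟩
      exact hx rfl
    · intro h
      exact absurd (Finset.mem_univ _) h
  | cons ω e =>
    rw [dif_pos (by simp), toTarget_snd_apply, Finset.sum_eq_zero, zero_add]
    intro x _
    refine DirectSum.of_eq_of_ne _ _ _ fun h => ?_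
    have h' := congrArg (fun γ : Cycle V n => γ.path.length) h
    simp at h'

/-- The component along a cycle is multiplicative: it takes a cup product to the sum of the
products along all the ways to write the cycle as a concatenation of two cycles. -/
theorem toCycle_cup (p q : ℕ) (u : HH k Δ.Lam p) (v : HH k Δ.Lam q) (γ : Cycle V (p + q)) :
    Δ.toCycle γ.path (p + q) (HH.cup k Δ.Lam p q u v) =
      ∑ γ' : Cycle V p, ∑ γ'' : Cycle V q,
        Δ.cycleCupAux p q γ' γ'' (Δ.toCycle γ'.path p u) (Δ.toCycle γ''.path q v) γ := by
  obtain ⟨f, rfl⟩ := Cohomology.mk_surjective _ _ u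
  obtain ⟨g, rfl⟩ := Cohomology.mk_surjective _ _ v
  have h1 : Represents (X := Δ.KCochain γ.path) (Δ.kd γ.path)
      (Δ.component γ.path (p + q) (cup p q (p + q) rfl f.1 g.1))
      (Δ.toCycle γ.path (p + q) (HH.cup k Δ.Lam p q
        (Cohomology.mk (X := HCochain k Δ.Lam) hd p f)
        (Cohomology.mk (X := HCochain k Δ.Lam) hd q g))) := ⟨_, rfl⟩
  refine h1.eq_of_sub_mem (Represents.sum _ fun γ' => Represents.sum _ fun γ'' =>
    Δ.represents_cycleCupAux γ' γ'' γ _ _) ?_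
  have h2 := Δ.component_cup_sub_mem_coboundaries γ.path rfl f.1 g.1 f.2 g.2
  rw [Δ.cyclePart_eq_sum p, Δ.cyclePart_eq_sum q] at h2
  simp only [map_sum, LinearMap.sum_apply] at h2
  rw [Finset.sum_comm] at h2
  exact h2

theorem toTarget_cup (p q : ℕ) (u : HH k Δ.Lam p) (v : HH k Δ.Lam q) :
    Δ.toTarget (p + q) (HH.cup k Δ.Lam p q u v) =
      Target.cup Δ (Δ.toTarget p u) (Δ.toTarget q v) := by
  refine Prod.ext (Δ.toAlg_cup p q u v) (DFinsupp.ext fun γ => ?_)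
  refine (Δ.toTarget_snd_apply _ _ γ).trans ((Δ.toCycle_cup p q u v γ.toCycle).trans ?_)
  refine Eq.symm ((Δ.dropVertices_apply _ _ γ).trans ((Δ.cycleCup_apply p q _ _ _).trans ?_))
  simp only [toCycleCoh_toTarget_apply]

theorem toTarget_one : Δ.toTarget 0 (HH.one k Δ.Lam) = Target.one Δ := by
  refine Prod.ext ?_ (DFinsupp.ext fun γ => absurd γ.length_pos γ.length_le.not_gt)
  exact congrArg (Cohomology.mk (X := HCochain k Δ.Alg) hd 0)
    (Subtype.ext (MultilinearMap.ext fun _ => rfl))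

end Maps

end QSet

end QSets

end

end HochschildPaths

/-- Let `k` be a field, let `Q` be a finite simply laced quiver, and let `Δ` be a `Q`-set with zero
compositions. The cup product of `HH^*(Λ_Δ)` is zero on the images of the cohomologies along the
paths that are not cycles, in all degrees, and already on the cocycles of the subcomplex `D` of the
cochains along these paths. The maps `HH^n(Λ_Δ) → HH^n(A) ⊕ ⊕_γ H^n_γ(Δ)`, over the cycles `γ` that
are not vertices, form a morphism of graded algebras. -/
theorem mainTheorem5 {k : Type*} [Field k] {V : Type*} [Quiver V] [Finite V]
    [∀ x y : V, Subsingleton (x ⟶ y)] [∀ x : V, IsEmpty (x ⟶ x)] (Δ : HochschildPaths.QSet k V) :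
    (∀ (p q : ℕ) (u : ⨁ δ : HochschildPaths.NonCycle V p, Δ.KH δ.path p)
        (v : ⨁ δ : HochschildPaths.NonCycle V q, Δ.KH δ.path q),
      HochschildPaths.HH.cup k Δ.Lam p q (Δ.fromNonCycles p u) (Δ.fromNonCycles q v) = 0) ∧
    (∀ (p q : ℕ), ∀ f ∈ Δ.nonCycleCochains p, ∀ g ∈ Δ.nonCycleCochains q,
      HochschildPaths.hd p (p + 1) rfl f = 0 → HochschildPaths.hd q (q + 1) rfl g = 0 →
        HochschildPaths.cup p q (p + q) rfl f g = 0) ∧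
    Δ.toTarget 0 (HochschildPaths.HH.one k Δ.Lam) = HochschildPaths.QSet.Target.one Δ ∧
    (∀ (p q : ℕ) (u : HochschildPaths.HH k Δ.Lam p) (v : HochschildPaths.HH k Δ.Lam q),
      Δ.toTarget (p + q) (HochschildPaths.HH.cup k Δ.Lam p q u v) =
        HochschildPaths.QSet.Target.cup Δ (Δ.toTarget p u) (Δ.toTarget q v)) :=
  ⟨Δ.cup_fromNonCycles,
    fun _ _ _ hf _ hg _ _ => Δ.cup_eq_zero_of_mem_nonCycleCochains rfl hf hg,
    Δ.toTarget_one, Δ.toTarget_cup⟩
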